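/- Let $M$ be a smooth manifold of dimension $m+n$ (Hausdorff, second countable, without boundary), and let $D$ be a smooth $m$-dimensional distribution on $M$: each $D_x\subseteq T_xM$ is an $m$-dimensional subspace, and locally $D$ is spanned by $m$ smooth vector fields. Write $X\in D$ if $X$ is a smooth vector field on $M$ with $X(x)\in D_x$ for all $x\in M$. An integral manifold of $D$ is a (second countable, not necessarily connected) injectively immersed submanifold $N\subseteq M$ of some dimension $k$ with $T_xN\subseteq D_x$ for all $x\in N$. It is called maximal if it cannot be enlarged around any of its points, i.e. if for no $x\in N$ and no open neighbourhood $U$ of $x$ in $M$ is $N\cap U$ contained in an integral manifold of dimension larger than $\dim N$. The distribution $D$ is called completely integrable if $T_xN=D_x$ for every maximal integral manifold $N$ of $D$ and every $x\in N$. A vector field $X$ is called a symmetry of $D$ if its flow satisfies $(\mathrm{Fl}^X_t)_*D_x=D_{\mathrm{Fl}^X_t(x)}$ for all $t$ and $x$ for which $\mathrm{Fl}^X_t$ is defined near $x$. Theorem (Frobenius). 1. $D$ is completely integrable if and only if it is closed under the Lie bracket, i.e. $[X,Y]\in D$ for all $X,Y\in D$. 2. $D$ is closed under the Lie bracket if and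 only if through every point of $M$ there passes an integral manifold $N$ of $D$ with $T_yN=D_y$ for all $y\in N$. 3. If $D$ is closed under the Lie bracket, then every $X\in D$ is a symmetry of $D$, and every $X\in D$ is tangent to every maximal integral manifold $N$ of $D$, i.e. $X(x)\in T_xN$ for all $x\in N$. -/

import Mathlib

open scoped Manifold ContDiff Topology

universe u

/-- Smoothness, on a subset `U` of the `d`-dimensional manifold `M`, of a vector field on `M`. -/
def SmoothVectorFieldOn {d : ℕ} {M : Type u} [TopologicalSpace M]
    [ChartedSpace (EuclideanSpace ℝ (Fin d)) M] [IsManifold (𝓡 d) ∞ M]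
    (X : ∀ x : M, TangentSpace (𝓡 d) x) (U : Set M) : Prop :=
  ContMDiffOn (𝓡 d) (𝓡 d).tangent ∞ (fun x => (⟨x, X x⟩ : TangentBundle (𝓡 d) M)) U

/-- A smooth `m`-dimensional (tangent) distribution on the `d`-dimensional manifold `M`: a choice of
an `m`-dimensional subspace of each tangent space, locally spanned by `m` smooth vector fields. -/
structure SmoothDistribution (m d : ℕ) (M : Type u) [TopologicalSpace M]
    [ChartedSpace (EuclideanSpace ℝ (Fin d)) M] [IsManifold (𝓡 d) ∞ M] where
  space : ∀ x : M, Submodule ℝ (TangentSpace (𝓡 d) x)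
  finrank_space : ∀ x : M, Module.finrank ℝ (space x) = m
  smooth : ∀ x : M, ∃ U : Set M, IsOpen U ∧ x ∈ U ∧
    ∃ X : Fin m → ∀ y : M, TangentSpace (𝓡 d) y,
      (∀ i, SmoothVectorFieldOn (X i) U) ∧
      ∀ y ∈ U, space y = Submodule.span ℝ (Set.range fun i => X i y)

namespace SmoothDistribution

variable {m d : ℕ} {M : Type u} [TopologicalSpace M]
  [ChartedSpace (EuclideanSpace ℝ (Fin d)) M] [IsManifold (𝓡 d) ∞ M]

/-- `X` is a (global) smooth vector field on `M` that belongs to the distribution `D`. -/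
def IsSection (D : SmoothDistribution m d M) (X : ∀ x : M, TangentSpace (𝓡 d) x) : Prop :=
  SmoothVectorFieldOn X Set.univ ∧ ∀ x : M, X x ∈ D.space x

/-- `D` is closed under the Lie bracket. -/
def IsInvolutive (D : SmoothDistribution m d M) : Prop :=
  ∀ X Y : ∀ x : M, TangentSpace (𝓡 d) x, D.IsSection X → D.IsSection Y →
    ∀ x : M, VectorField.mlieBracket (𝓡 d) X Y x ∈ D.space x

/-- The injective immersion `ι : N → M` of a `k`-dimensional manifold `N` exhibits `N` as an
integral manifold of `D`: every tangent space of `N` is contained in `D`. -/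
structure IsIntegralManifold (D : SmoothDistribution m d M) (k : ℕ) {N : Type u}
    [TopologicalSpace N] [ChartedSpace (EuclideanSpace ℝ (Fin k)) N] (ι : N → M) : Prop where
  immersion : Manifold.IsImmersion (𝓡 k) (𝓡 d) ∞ ι
  injective : Function.Injective ι
  tangent_le : ∀ p : N, LinearMap.range (mfderiv (𝓡 k) (𝓡 d) ι p).toLinearMap ≤ D.space (ι p)

/-- The integral manifold `ι : N → M` is maximal: it cannot be enlarged around any of its points,
i.e. for no `x = ι p` in `N` and no open neighbourhood `U` of `x` in `M` is the piece `N ∩ U`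
contained in an integral manifold `N'` of larger dimension. -/
def IsMaximalIntegralManifold (D : SmoothDistribution m d M) (k : ℕ) {N : Type u}
    [TopologicalSpace N] [ChartedSpace (EuclideanSpace ℝ (Fin k)) N] (ι : N → M) : Prop :=
  D.IsIntegralManifold k ι ∧
  ∀ (p : N) (U : Set M), IsOpen U → ι p ∈ U →
    ∀ (k' : ℕ) (N' : Type u) [TopologicalSpace N'] [SecondCountableTopology N']
      [ChartedSpace (EuclideanSpace ℝ (Fin k')) N'] [IsManifold (𝓡 k') ∞ N'] (ι' : N' → M),
      k < k' → D.IsIntegralManifold k' ι' → ¬ (Set.range ι ∩ U ⊆ Set.range ι')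

/-- `D` is completely integrable: `T_x N = D_x` for every maximal integral manifold `N` of `D` and
every `x` in `N`. -/
def IsCompletelyIntegrable (D : SmoothDistribution m d M) : Prop :=
  ∀ (k : ℕ) (N : Type u) [TopologicalSpace N] [SecondCountableTopology N]
    [ChartedSpace (EuclideanSpace ℝ (Fin k)) N] [IsManifold (𝓡 k) ∞ N] (ι : N → M),
    D.IsMaximalIntegralManifold k ι →
    ∀ p : N, LinearMap.range (mfderiv (𝓡 k) (𝓡 d) ι p).toLinearMap = D.space (ι p)

/-- Through every point of `M` there passes an integral manifold `N` of `D` with `T_y N = D_y` for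
every `y` in `N`. -/
def HasFullIntegralManifolds (D : SmoothDistribution m d M) : Prop :=
  ∀ x : M, ∃ (N : Type u) (_ : TopologicalSpace N) (_ : SecondCountableTopology N)
    (_ : ChartedSpace (EuclideanSpace ℝ (Fin m)) N) (_ : IsManifold (𝓡 m) ∞ N) (ι : N → M),
    D.IsIntegralManifold m ι ∧ x ∈ Set.range ι ∧
    ∀ p : N, LinearMap.range (mfderiv (𝓡 m) (𝓡 d) ι p).toLinearMap = D.space (ι p)

end SmoothDistribution

/-- `φ`, restricted to times in the open interval `J` around `0` and to initial points in the open
set `U`, is the (smooth, possibly local) flow `Fl^X` of the vector field `X`. When the flow of `X`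
is complete this includes the case `J = ℝ` and `U = M`. -/
structure IsFlowOn {d : ℕ} {M : Type u} [TopologicalSpace M]
    [ChartedSpace (EuclideanSpace ℝ (Fin d)) M] [IsManifold (𝓡 d) ∞ M]
    (X : ∀ x : M, TangentSpace (𝓡 d) x) (J : Set ℝ) (U : Set M) (φ : ℝ → M → M) : Prop where
  isOpen_time : IsOpen J
  ordConnected_time : J.OrdConnected
  zero_mem_time : (0 : ℝ) ∈ J
  isOpen_space : IsOpen U
  map_zero : ∀ x ∈ U, φ 0 x = x
  integralCurve : ∀ x ∈ U, IsMIntegralCurveOn (fun t => φ t x) X J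
  smooth : ContMDiffOn (𝓘(ℝ, ℝ).prod (𝓡 d)) (𝓡 d) ∞ (fun q : ℝ × M => φ q.1 q.2) (J ×ˢ U)

/-- The vector field `X` is an (infinitesimal) symmetry of `D`: its flow `φ` satisfies
`(φ_t)_* D_x = D_{φ_t(x)}` for all `t` and `x` for which it is defined. -/
def SmoothDistribution.IsInfinitesimalSymmetry {m d : ℕ} {M : Type u} [TopologicalSpace M]
    [ChartedSpace (EuclideanSpace ℝ (Fin d)) M] [IsManifold (𝓡 d) ∞ M]
    (D : SmoothDistribution m d M) (X : ∀ x : M, TangentSpace (𝓡 d) x) : Prop :=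
  ∀ (J : Set ℝ) (U : Set M) (φ : ℝ → M → M), IsFlowOn X J U φ →
    ∀ t ∈ J, ∀ x ∈ U,
      (D.space x).map (mfderiv (𝓡 d) (𝓡 d) (φ t) x).toLinearMap = D.space (φ t x)

/-!
Locally, a distribution `D` of rank `m` is a field of graphs: in suitable coordinates with values in
`ℝᵐ × ℝⁿ`, a vector `(a, b)` at `z` lies in `D` if and only if `b = A z a`, with a smooth slope `A`
(`SmoothDistribution.exists_isGraphIn`). Graphs of functions `f` tangent to `D` are solutions of the
total differential equation `Df(x) = A(x, f(x))`. Extending the sections `z ↦ (a, A z a)` by bump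
functions, one sees that involutivity of `D` is the integrability condition
`DA(a, A a) b = DA(b, A b) a` (`IsGraphIn.integrability`). Under this condition the total
differential equation is solvable for all initial values near a given point, on a common ball
(`exists_total_solution`, `exists_uniform_total_solutions`), and the graphs of the solutions are
integral manifolds of full dimension.

Conversely, an integral manifold of full dimension is a slice in suitable coordinates, and sections
of `D` are tangent to it; so brackets of sections are tangent to it as well
(`IsIntegralManifold.mlieBracket_mem`).

For the criterion by maximal integral manifolds let first `D` be involutive. An integral manifold `N`
of any dimension stays locally inside each leaf that it meets, by uniqueness for linear differential
inequalities. As `N` is second countable, a small piece of it meets only countably many leaves, and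
the disjoint union of these is an integral manifold of full dimension that contains the piece
(`IsIntegralManifold.exists_enlargement`). Hence a maximal integral manifold has full dimension. If,
on the other hand, the bracket of two sections is not in `D` at some point, it is not in `D` on an
open set `U`, and no integral manifold of full dimension meets `U`. Points are integral manifolds, so
there is an integral manifold of the largest possible dimension among those that meet `U`, and its
restriction to `U` is maximal without having full dimension
(`SmoothDistribution.exists_isMaximalIntegralManifold`).

Finally, the flow of a section `X` of an involutive `D` preserves `D`: for a tangent vector moved by
the flow, with coordinates `W`, the defect `W.2 - A W.1` satisfies a homogeneous linear differential
equation by the integrability condition (`hasDerivAt_defect`), so that it vanishes at all times if it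
vanishes at time zero.
-/

open Set Filter Metric

/-! ### Total differential equations -/

section TotalDifferentialEquation

variable {E F : Type*} [NormedAddCommGroup E] [NormedSpace ℝ E]
  [NormedAddCommGroup F] [NormedSpace ℝ F]

/-- Existence for `g' = v (t, g)` on `[0, 1]` with the solution confined to a closed ball. -/
theorem exists_solution_mem_closedBall [CompleteSpace F] {v : ℝ → F → F} {y₁ : F} {ρ C K : ℝ}
    (hρ : 0 ≤ ρ) (hC0 : 0 ≤ C) (hC : C ≤ ρ) (hK : 0 ≤ K)
    (hlip : ∀ t ∈ Icc (0 : ℝ) 1, ∀ y ∈ closedBall y₁ ρ, ∀ y' ∈ closedBall y₁ ρ,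
      ‖v t y - v t y'‖ ≤ K * ‖y - y'‖)
    (hcont : ∀ y ∈ closedBall y₁ ρ, ContinuousOn (fun t => v t y) (Icc 0 1))
    (hbound : ∀ t ∈ Icc (0 : ℝ) 1, ∀ y ∈ closedBall y₁ ρ, ‖v t y‖ ≤ C) :
    ∃ g : ℝ → F, g 0 = y₁ ∧ (∀ t, g t ∈ closedBall y₁ ρ) ∧
      ∀ t ∈ Icc (0 : ℝ) 1, HasDerivWithinAt g (v t (g t)) (Icc 0 1) t := by
  lift ρ to NNReal using hρ
  lift C to NNReal using hC0
  lift K to NNReal using hK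
  have hPL : IsPicardLindelof v (⟨0, by simp⟩ : Icc (0 : ℝ) 1) y₁ ρ 0 C K :=
    { lipschitzOnWith := fun t ht => LipschitzOnWith.of_dist_le_mul fun y hy y' hy' => by
        rw [dist_eq_norm, dist_eq_norm]; exact hlip t ht y hy y' hy'
      continuousOn := hcont
      norm_le := hbound
      mul_max_le := by simpa using hC }
  have hy : y₁ ∈ closedBall y₁ ((0 : NNReal) : ℝ) := by simp
  obtain ⟨α, hα⟩ := ODE.FunSpace.exists_isFixedPt_next hPL hy
  refine ⟨α.compProj, ?_, fun t => α.compProj_mem_closedBall hPL.mul_max_le, fun t ht => ?_⟩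
  · have : α.compProj ((⟨0, by simp⟩ : Icc (0 : ℝ) 1) : ℝ) = y₁ := by
      rw [ODE.FunSpace.compProj_val, ← hα, ODE.FunSpace.next_apply₀]
    exact this
  · apply ODE.hasDerivWithinAt_picard_Icc (by simp : (0 : ℝ) ∈ Icc (0 : ℝ) 1)
      hPL.continuousOn_uncurry α.continuous_compProj.continuousOn
      (fun _ _ => α.compProj_mem_closedBall hPL.mul_max_le) y₁ ht |>.congr_of_mem _ ht
    intro t' ht'
    nth_rw 1 [← hα]
    rw [ODE.FunSpace.compProj_of_mem ht', ODE.FunSpace.next_apply]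

/-- First-order Taylor estimate for a map with Lipschitz derivative. -/
theorem norm_sub_sub_fderiv_le_sq {A : E → F} {s : Set E} {C : ℝ} (hs : Convex ℝ s)
    (hC : 0 ≤ C) (hA : ∀ z ∈ s, DifferentiableAt ℝ A z)
    (hlip : ∀ z ∈ s, ∀ w ∈ s, ‖fderiv ℝ A z - fderiv ℝ A w‖ ≤ C * ‖z - w‖)
    {z w : E} (hz : z ∈ s) (hw : w ∈ s) :
    ‖A w - A z - fderiv ℝ A z (w - z)‖ ≤ C * ‖w - z‖ ^ 2 := by
  have hsub : segment ℝ z w ⊆ s := hs.segment_subset hz hw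
  have := (convex_segment (𝕜 := ℝ) z w).norm_image_sub_le_of_norm_fderiv_le' (f := A)
    (φ := fderiv ℝ A z) (C := C * ‖w - z‖) (fun x hx => hA x (hsub hx))
    (fun x hx => (hlip x (hsub hx) z hz).trans ?_) (left_mem_segment ℝ z w)
    (right_mem_segment ℝ z w)
  · calc _ ≤ _ := this
      _ = _ := by ring
  · gcongr
    obtain ⟨t, ht, rfl⟩ := (segment_eq_image' ℝ z w ▸ hx : x ∈ _)
    simp only [add_sub_cancel_left, norm_smul, Real.norm_eq_abs, abs_of_nonneg ht.1]
    exact mul_le_of_le_one_left (norm_nonneg _) ht.2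

theorem gronwallBound_zero_eq_mul (K ε x : ℝ) :
    gronwallBound 0 K ε x = ε * gronwallBound 0 K 1 x := by
  unfold gronwallBound
  split_ifs <;> ring

/-- Local solvability of the total differential equation `Df(x) = A(x, f(x))` under the
integrability condition `h_int`. The solution at `x` is the time-one value of the ordinary
differential equation along the segment from `x₁` to `x`; by the integrability condition,
`g + t A(·, g) k` solves the equation along the segment to `x + k` up to an error `O(‖k‖²)`, and
Grönwall's inequality yields differentiability. -/
theorem exists_total_solution [CompleteSpace F] {A : E × F → E →L[ℝ] F} {x₁ : E} {y₁ : F}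
    {r ρ C₀ C₁ C₂ : ℝ} (hr : 0 < r) (hρ : 0 < ρ) (hC₀ : 0 ≤ C₀) (hC₁ : 0 ≤ C₁) (hC₂ : 0 ≤ C₂)
    (hdiff : ∀ z ∈ closedBall x₁ r ×ˢ closedBall y₁ ρ, DifferentiableAt ℝ A z)
    (hA : ∀ z ∈ closedBall x₁ r ×ˢ closedBall y₁ ρ, ‖A z‖ ≤ C₀)
    (hA' : ∀ z ∈ closedBall x₁ r ×ˢ closedBall y₁ ρ, ‖fderiv ℝ A z‖ ≤ C₁)
    (hA'' : ∀ z ∈ closedBall x₁ r ×ˢ closedBall y₁ ρ, ∀ w ∈ closedBall x₁ r ×ˢ closedBall y₁ ρ,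
      ‖fderiv ℝ A z - fderiv ℝ A w‖ ≤ C₂ * ‖z - w‖)
    (hC : C₀ * r ≤ ρ)
    (h_int : ∀ z ∈ closedBall x₁ r ×ˢ closedBall y₁ ρ, ∀ a b : E,
      fderiv ℝ A z (a, A z a) b = fderiv ℝ A z (b, A z b) a) :
    ∃ f : E → F, f x₁ = y₁ ∧ ∀ x ∈ ball x₁ r, f x ∈ closedBall y₁ ρ ∧
      HasFDerivAt f (A (x, f x)) x := by
  set S := closedBall x₁ r ×ˢ closedBall y₁ ρ with hS
  have hSconv : Convex ℝ S := (convex_closedBall _ _).prod (convex_closedBall _ _)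
  -- the point on the segment at time `t` stays in the ball
  have hseg : ∀ h : E, ‖h‖ ≤ r → ∀ t ∈ Icc (0 : ℝ) 1, x₁ + t • h ∈ closedBall x₁ r := by
    intro h hh t ht
    rw [mem_closedBall, dist_eq_norm, add_sub_cancel_left, norm_smul, Real.norm_eq_abs,
      abs_of_nonneg ht.1]
    exact (mul_le_of_le_one_left (norm_nonneg _) ht.2).trans hh
  have hlipA : ∀ z ∈ S, ∀ w ∈ S, ‖A z - A w‖ ≤ C₁ * ‖z - w‖ := fun z hz w hw =>
    hSconv.norm_image_sub_le_of_norm_fderiv_le hdiff hA' hw hz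
  have hlip : ∀ h : E, ‖h‖ ≤ r → ∀ t ∈ Icc (0 : ℝ) 1, ∀ y ∈ closedBall y₁ ρ,
      ∀ y' ∈ closedBall y₁ ρ,
      ‖A (x₁ + t • h, y) h - A (x₁ + t • h, y') h‖ ≤ (C₁ * r) * ‖y - y'‖ := by
    intro h hh t ht y hy y' hy'
    rw [← sub_apply]
    refine (ContinuousLinearMap.le_opNorm _ _).trans ?_
    have := hlipA (x₁ + t • h, y) ⟨hseg h hh t ht, hy⟩ (x₁ + t • h, y') ⟨hseg h hh t ht, hy'⟩
    rw [Prod.mk_sub_mk, sub_self, Prod.norm_mk, norm_zero, max_eq_right (norm_nonneg _)] at this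
    calc _ ≤ (C₁ * ‖y - y'‖) * r := by gcongr
      _ = _ := by ring
  have hsol : ∀ h : E, ‖h‖ ≤ r → ∃ g : ℝ → F, g 0 = y₁ ∧ (∀ t, g t ∈ closedBall y₁ ρ) ∧
      ∀ t ∈ Icc (0 : ℝ) 1, HasDerivWithinAt g (A (x₁ + t • h, g t) h) (Icc 0 1) t := by
    intro h hh
    refine exists_solution_mem_closedBall (v := fun t y => A (x₁ + t • h, y) h) (C := C₀ * r)
      (K := C₁ * r) hρ.le (by positivity) hC (by positivity) (hlip h hh) ?_ ?_
    · intro y hy t ht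
      have h1 : ContinuousAt A (x₁ + t • h, y) := (hdiff _ ⟨hseg h hh t ht, hy⟩).continuousAt
      have h2 : ContinuousAt (fun t : ℝ => (x₁ + t • h, y)) t := by fun_prop
      have h3 : ContinuousAt (fun t : ℝ => A (x₁ + t • h, y)) t :=
        ContinuousAt.comp (f := fun t : ℝ => (x₁ + t • h, y)) h1 h2
      exact (h3.clm_apply continuousAt_const).continuousWithinAt
    · intro t ht y hy
      refine (ContinuousLinearMap.le_opNorm _ _).trans ?_
      have := hA _ (⟨hseg h hh t ht, hy⟩ : (x₁ + t • h, y) ∈ S)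
      gcongr
  choose! g hg0 hgmem hgder using hsol
  have hgcont : ∀ h : E, ‖h‖ ≤ r → ContinuousOn (g h) (Icc 0 1) := fun h hh t ht =>
    (hgder h hh t ht).continuousWithinAt
  -- all of these solutions have speed at most `C₀ * ‖h‖`
  have hgspeed : ∀ h : E, ‖h‖ ≤ r → ∀ t ∈ Icc (0 : ℝ) 1, ‖g h t - y₁‖ ≤ C₀ * ‖h‖ := by
    intro h hh t ht
    have h1 := norm_image_sub_le_of_norm_deriv_le_segment' (f := g h) (C := C₀ * ‖h‖)
      (fun t ht => hgder h hh t ht) (fun t ht => by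
        refine (ContinuousLinearMap.le_opNorm _ _).trans ?_
        have := hA _ (⟨hseg h hh t (Ico_subset_Icc_self ht), hgmem h hh t⟩ :
          (x₁ + t • h, g h t) ∈ S)
        gcongr) t ht
    rw [hg0 h hh, sub_zero] at h1
    exact h1.trans (mul_le_of_le_one_right (by positivity) ht.2)
  have hIci : ∀ {φ : ℝ → F} {φ' : F} {t : ℝ}, t ∈ Ico (0 : ℝ) 1 →
      HasDerivWithinAt φ φ' (Icc 0 1) t → HasDerivWithinAt φ φ' (Ici t) t := fun ht hφ =>
    (hφ.mono (Icc_subset_Icc_left ht.1)).mono_of_mem_nhdsWithin (Icc_mem_nhdsGE ht.2)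
  refine ⟨fun x => g (x - x₁) 1, ?_, fun x hx => ?_⟩
  · have := hgspeed 0 (by simpa using hr.le) 1 (by simp)
    simpa [sub_eq_zero] using this
  set h := x - x₁ with hh_def
  have hh : ‖h‖ < r := by rw [hh_def, ← dist_eq_norm]; exact hx
  have hx1 : x₁ + (1 : ℝ) • h = x := by simp [hh_def]
  refine ⟨hgmem h hh.le 1, ?_⟩
  set B := 1 + C₀ with hB
  set Cε := C₁ * B + C₂ * B ^ 2 * r with hCε
  set Γ := gronwallBound 0 (C₁ * r) 1 1 with hΓ
  -- the `O(‖k‖²)` comparison with the solution along the perturbed segment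
  have key : ∀ k : E, ‖h‖ + ‖k‖ ≤ r →
      ‖g (h + k) 1 - g h 1 - A (x, g h 1) k‖ ≤ (Cε * Γ) * ‖k‖ ^ 2 := by
    intro k hk
    have hhk : ‖h + k‖ ≤ r := (norm_add_le _ _).trans hk
    -- `R` approximates the solution along the segment to `x + k`; its time derivative involves
    -- `fderiv A (h, A h) k`, which `h_int` turns into the term `fderiv A (k, A k) h` of the Taylor
    -- expansion of the right-hand side
    set R : ℝ → F := fun t => g h t + t • A (x₁ + t • h, g h t) k with hR
    set z : ℝ → E × F := fun t => (x₁ + t • h, g h t) with hz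
    have hzS : ∀ t ∈ Icc (0 : ℝ) 1, z t ∈ S := fun t ht => ⟨hseg h hh.le t ht, hgmem h hh.le t⟩
    have hzder : ∀ t ∈ Icc (0 : ℝ) 1, HasDerivWithinAt z (h, A (z t) h) (Icc 0 1) t := by
      intro t ht
      refine HasDerivWithinAt.prodMk ?_ (hgder h hh.le t ht)
      simpa using ((hasDerivWithinAt_id t _).smul_const h).const_add x₁
    have hRder : ∀ t ∈ Icc (0 : ℝ) 1, HasDerivWithinAt R
        (A (z t) h + (t • fderiv ℝ A (z t) (h, A (z t) h) k + A (z t) k)) (Icc 0 1) t := by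
      intro t ht
      have h1 : HasDerivWithinAt (fun t => A (z t)) (fderiv ℝ A (z t) (h, A (z t) h)) (Icc 0 1) t :=
        (hdiff _ (hzS t ht)).hasFDerivAt.comp_hasDerivWithinAt t (hzder t ht)
      have h2 : HasDerivWithinAt (fun t => A (z t) k) (fderiv ℝ A (z t) (h, A (z t) h) k)
          (Icc 0 1) t := by
        simpa using h1.clm_apply (hasDerivWithinAt_const t _ k)
      have h3 := (hasDerivWithinAt_id t (Icc 0 1)).smul h2
      have h4 := (hgder h hh.le t ht).add h3
      simp only [id_eq, one_smul] at h4
      exact h4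
    have hRmem : ∀ t ∈ Icc (0 : ℝ) 1, R t ∈ closedBall y₁ ρ := by
      intro t ht
      rw [mem_closedBall, dist_eq_norm]
      have h1 : ‖t • A (z t) k‖ ≤ C₀ * ‖k‖ := by
        rw [norm_smul, Real.norm_eq_abs, abs_of_nonneg ht.1]
        refine (mul_le_of_le_one_left (norm_nonneg _) ht.2).trans ?_
        refine (ContinuousLinearMap.le_opNorm _ _).trans ?_
        have := hA _ (hzS t ht)
        gcongr
      calc ‖R t - y₁‖ = ‖(g h t - y₁) + t • A (z t) k‖ := by
            simp only [hR, hz]; congr 1; abel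
        _ ≤ C₀ * ‖h‖ + C₀ * ‖k‖ := (norm_add_le _ _).trans
            (add_le_add (hgspeed h hh.le t ht) h1)
        _ = C₀ * (‖h‖ + ‖k‖) := by ring
        _ ≤ C₀ * r := by gcongr
        _ ≤ ρ := hC
    have herr : ∀ t ∈ Icc (0 : ℝ) 1,
        ‖A (z t) h + (t • fderiv ℝ A (z t) (h, A (z t) h) k + A (z t) k) -
          A (x₁ + t • (h + k), R t) (h + k)‖ ≤ Cε * ‖k‖ ^ 2 := by
      intro t ht
      set w : E × F := (x₁ + t • (h + k), R t) with hw
      have hwS : w ∈ S := ⟨hseg _ hhk t ht, hRmem t ht⟩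
      have hwz : w - z t = t • (k, A (z t) k) := by
        simp only [hw, hz, hR, Prod.mk_sub_mk, Prod.smul_mk, Prod.mk.injEq, smul_add]
        constructor <;> abel
      have hwn : ‖w - z t‖ ≤ B * ‖k‖ := by
        rw [hwz, norm_smul, Real.norm_eq_abs, abs_of_nonneg ht.1]
        refine (mul_le_of_le_one_left (norm_nonneg _) ht.2).trans ?_
        have h1 : ‖A (z t) k‖ ≤ C₀ * ‖k‖ := by
          refine (ContinuousLinearMap.le_opNorm _ _).trans ?_
          have := hA _ (hzS t ht)
          gcongr
        rw [Prod.norm_mk]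
        refine max_le ?_ (h1.trans ?_)
        · rw [hB]; nlinarith [norm_nonneg k]
        · rw [hB]; nlinarith [norm_nonneg k]
      have htay := norm_sub_sub_fderiv_le_sq hSconv hC₂ hdiff hA'' (hzS t ht) hwS
      set rem := A w - A (z t) - fderiv ℝ A (z t) (w - z t) with hrem
      have hint : t • fderiv ℝ A (z t) (h, A (z t) h) k = fderiv ℝ A (z t) (w - z t) h := by
        rw [hwz, map_smul, smul_apply, h_int _ (hzS t ht) h k]
      have hAw : A w = A (z t) + fderiv ℝ A (z t) (w - z t) + rem := by rw [hrem]; abel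
      have heq : A (z t) h + (t • fderiv ℝ A (z t) (h, A (z t) h) k + A (z t) k) - A w (h + k)
          = -(fderiv ℝ A (z t) (w - z t) k) - rem (h + k) := by
        rw [hint, hAw]
        simp only [add_apply, map_add]
        abel
      rw [heq]
      have e1 : ‖fderiv ℝ A (z t) (w - z t) k‖ ≤ C₁ * (B * ‖k‖) * ‖k‖ := by
        refine (ContinuousLinearMap.le_opNorm _ _).trans ?_
        gcongr
        refine (ContinuousLinearMap.le_opNorm _ _).trans ?_
        have := hA' _ (hzS t ht)
        gcongr
      have e2 : ‖rem (h + k)‖ ≤ C₂ * (B * ‖k‖) ^ 2 * r := by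
        refine (ContinuousLinearMap.le_opNorm _ _).trans ?_
        have : ‖rem‖ ≤ C₂ * (B * ‖k‖) ^ 2 := htay.trans (by gcongr)
        gcongr
      calc _ ≤ ‖fderiv ℝ A (z t) (w - z t) k‖ + ‖rem (h + k)‖ := by
            refine (norm_sub_le _ _).trans ?_
            rw [norm_neg]
        _ ≤ C₁ * (B * ‖k‖) * ‖k‖ + C₂ * (B * ‖k‖) ^ 2 * r := add_le_add e1 e2
        _ = _ := by rw [hCε]; ring
    obtain ⟨K, hK⟩ : ∃ K : NNReal, (K : ℝ) = C₁ * r :=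
      ⟨Real.toNNReal _, Real.coe_toNNReal _ (by positivity)⟩
    have hgr := dist_le_of_approx_trajectories_ODE_of_mem
      (v := fun t y => A (x₁ + t • (h + k), y) (h + k)) (s := fun _ => closedBall y₁ ρ)
      (K := K) (f := g (h + k)) (g := R) (a := 0) (b := 1) (δ := 0)
      (εf := 0) (εg := Cε * ‖k‖ ^ 2)
      (fun t ht => LipschitzOnWith.of_dist_le_mul fun y hy y' hy' => by
        rw [dist_eq_norm, dist_eq_norm, hK]
        exact hlip _ hhk t (Ico_subset_Icc_self ht) y hy y' hy')
      (hgcont _ hhk) (fun t ht => hIci ht (hgder _ hhk t (Ico_subset_Icc_self ht)))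
      (fun t ht => by rw [dist_self])
      (fun t ht => hgmem _ hhk t)
      (fun t ht => (hRder t ht).continuousWithinAt)
      (fun t ht => hIci ht (hRder t (Ico_subset_Icc_self ht)))
      (fun t ht => by rw [dist_eq_norm]; exact herr t (Ico_subset_Icc_self ht))
      (fun t ht => hRmem t (Ico_subset_Icc_self ht))
      (by simp [hR, hg0 _ hhk, hg0 _ hh.le]) 1 (by simp)
    rw [zero_add, sub_zero, gronwallBound_zero_eq_mul, dist_eq_norm] at hgr
    have hR1 : R 1 = g h 1 + A (x, g h 1) k := by simp only [hR]; rw [hx1, one_smul]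
    rw [hR1, ← sub_sub] at hgr
    calc _ ≤ _ := hgr
      _ = _ := by rw [hΓ, hK]; ring
  rw [hasFDerivAt_iff_isLittleO_nhds_zero]
  refine (Asymptotics.IsBigO.of_bound (Cε * Γ) (g := fun k : E => ‖k‖ ^ 2) ?_).trans_isLittleO ?_
  · have : ∀ᶠ k : E in 𝓝 0, ‖h‖ + ‖k‖ < r := by
      have : ContinuousAt (fun k : E => ‖h‖ + ‖k‖) 0 := by fun_prop
      exact this.eventually_lt continuousAt_const (by simpa using hh)
    filter_upwards [this] with k hk
    have := key k hk.le
    have e : x + k - x₁ = h + k := by rw [hh_def]; abel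
    rw [e]
    simpa using this
  · exact Asymptotics.isLittleO_norm_pow_id one_lt_two

theorem eventually_norm_lt {X G : Type*} [TopologicalSpace X] [NormedAddCommGroup G] {f : X → G}
    {x : X} (hf : ContinuousAt f x) : ∀ᶠ z in 𝓝 x, ‖f z‖ < ‖f x‖ + 1 :=
  hf.norm.eventually_lt continuousAt_const (lt_add_one _)

/-- Solutions of a total differential equation with smooth coefficients are smooth: the equation
expresses the derivative of `f` through `f`, so that regularity improves by induction. -/
theorem contDiffOn_of_total_solution {A : E × F → E →L[ℝ] F} {Ω : Set (E × F)} {V : Set E}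
    (hV : IsOpen V) (hA : ContDiffOn ℝ ∞ A Ω) {f : E → F}
    (hΩ : ∀ x ∈ V, (x, f x) ∈ Ω) (hf : ∀ x ∈ V, HasFDerivAt f (A (x, f x)) x) :
    ContDiffOn ℝ ∞ f V := by
  rw [contDiffOn_infty]
  intro n
  induction n with
  | zero =>
    exact contDiffOn_zero.2 fun x hx => (hf x hx).continuousAt.continuousWithinAt
  | succ n ih =>
    have h : ContDiffOn ℝ n (fderiv ℝ f) V := by
      have h1 : ContDiffOn ℝ n (fun x => A (x, f x)) V :=
        (hA.of_le (by exact_mod_cast le_top)).comp (contDiffOn_id.prodMk ih) hΩ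
      exact h1.congr fun x hx => (hf x hx).fderiv
    have := (contDiffOn_succ_iff_fderiv_of_isOpen (n := n) hV).2
      ⟨fun x hx => (hf x hx).differentiableAt.differentiableWithinAt, by simp, h⟩
    exact_mod_cast this

/-- If a smooth `A` satisfies the integrability condition near `z₀`, then through every point of
one and the same product of balls around `z₀` there passes the graph of a smooth solution of
`Df(x) = A(x, f(x))` that is defined on one and the same ball. -/
theorem exists_uniform_total_solutions [CompleteSpace F] {A : E × F → E →L[ℝ] F}
    {Ω : Set (E × F)} (hΩ : IsOpen Ω) (hA : ContDiffOn ℝ ∞ A Ω)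
    (h_int : ∀ z ∈ Ω, ∀ a b : E, fderiv ℝ A z (a, A z a) b = fderiv ℝ A z (b, A z b) a)
    {z₀ : E × F} (hz₀ : z₀ ∈ Ω) :
    ∃ r > 0,
      ∀ x₁ ∈ ball z₀.1 r, ∀ y₁ ∈ ball z₀.2 r, ∃ f : E → F, f x₁ = y₁ ∧
        ContDiffOn ℝ ∞ f (ball z₀.1 r) ∧
        ∀ x ∈ ball z₀.1 r, (x, f x) ∈ Ω ∧ HasFDerivAt f (A (x, f x)) x := by
  have hAt : ContDiffAt ℝ ∞ A z₀ := hA.contDiffAt (hΩ.mem_nhds hz₀)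
  have hDAt : ContDiffAt ℝ 1 (fderiv ℝ A) z₀ := hAt.fderiv_right (m := 1) (by decide)
  obtain ⟨C₂, s, hs, hlip⟩ := hDAt.exists_lipschitzOnWith
  set C₀ := ‖A z₀‖ + 1 with hC₀
  set C₁ := ‖fderiv ℝ A z₀‖ + 1 with hC₁
  have h0 : ∀ᶠ z in 𝓝 z₀, ‖A z‖ < C₀ :=
    eventually_norm_lt hAt.continuousAt
  have h1 : ∀ᶠ z in 𝓝 z₀, ‖fderiv ℝ A z‖ < C₁ := eventually_norm_lt hDAt.continuousAt
  have hall := (h0.and h1).and ((show ∀ᶠ z in 𝓝 z₀, z ∈ s from hs).and (hΩ.mem_nhds hz₀))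
  obtain ⟨δ, hδ, hball⟩ := Metric.eventually_nhds_iff_ball.1 hall
  have hC₀pos : 0 < C₀ := by positivity
  -- balls of radius `r` around the points of the ball of radius `r / 2` around `z₀.1` stay within
  -- distance `δ`, and solutions of speed at most `C₀` move by at most `δ / 4` over them
  set r := min (δ / 4) (δ / (4 * C₀)) with hr
  have hrpos : 0 < r := lt_min (by positivity) (by positivity)
  have hrδ : r ≤ δ / 4 := min_le_left _ _
  have hrC : C₀ * r ≤ δ / 4 := by
    calc C₀ * r ≤ C₀ * (δ / (4 * C₀)) := by gcongr; exact min_le_right _ _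
      _ = δ / 4 := by field_simp
  have hsub : ∀ x y, dist x z₀.1 < δ → dist y z₀.2 < δ → (x, y) ∈ ball z₀ δ := by
    intro x y hx hy
    rw [mem_ball, Prod.dist_eq]
    exact max_lt hx hy
  refine ⟨r / 2, by positivity, ?_⟩
  intro x₁ hx₁ y₁ hy₁
  rw [mem_ball] at hx₁ hy₁
  have hS : ∀ z ∈ closedBall x₁ r ×ˢ closedBall y₁ (δ / 4), z ∈ ball z₀ δ := by
    rintro ⟨x, y⟩ ⟨hx, hy⟩
    rw [mem_closedBall] at hx hy
    exact hsub x y (by linarith [dist_triangle x x₁ z₀.1])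
      (by linarith [dist_triangle y y₁ z₀.2])
  obtain ⟨f, hf1, hf⟩ := exists_total_solution (A := A) (x₁ := x₁) (y₁ := y₁) hrpos
    (by positivity : 0 < δ / 4) hC₀pos.le (by positivity : 0 ≤ C₁) C₂.2
    (fun z hz => ((hA.contDiffAt (hΩ.mem_nhds (hball z (hS z hz)).2.2)).differentiableAt
      (by simp)))
    (fun z hz => (hball z (hS z hz)).1.1.le) (fun z hz => (hball z (hS z hz)).1.2.le)
    (fun z hz w hw => by
      have := hlip.dist_le_mul z (hball z (hS z hz)).2.1 w (hball w (hS w hw)).2.1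
      rwa [dist_eq_norm, dist_eq_norm] at this)
    hrC (fun z hz => h_int z (hball z (hS z hz)).2.2)
  have hsubball : ball z₀.1 (r / 2) ⊆ ball x₁ r := by
    intro x hx
    rw [mem_ball] at hx ⊢
    linarith [dist_triangle_right x x₁ z₀.1]
  have hfΩ : ∀ x ∈ ball z₀.1 (r / 2), (x, f x) ∈ Ω := fun x hx =>
    (hball _ (hS _ ⟨ball_subset_closedBall (hsubball hx), (hf x (hsubball hx)).1⟩)).2.2
  exact ⟨f, hf1, contDiffOn_of_total_solution isOpen_ball hA hfΩ
    fun x hx => (hf x (hsubball hx)).2, fun x hx => ⟨hfΩ x hx, (hf x (hsubball hx)).2⟩⟩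

/-- A map `g` into `E × F` that is everywhere tangent to the field of graphs of `A`, and that meets
the graph of a solution `f` of `Df(x) = A(x, f(x))`, stays on that graph: along segments the defect
`(g z).2 - f (g z).1` satisfies a linear differential inequality. -/
theorem eventually_snd_eq_of_tangent {H : Type*} [NormedAddCommGroup H] [NormedSpace ℝ H]
    {A : E × F → E →L[ℝ] F} {g : H → E × F} {g' : H → H →L[ℝ] E × F} {z₀ : H}
    (hg : ∀ᶠ z in 𝓝 z₀, HasFDerivAt g (g' z) z) (hg' : ContinuousAt g' z₀)
    (htan : ∀ᶠ z in 𝓝 z₀, ∀ w, (g' z w).2 = A (g z) (g' z w).1)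
    (hA : ContDiffAt ℝ 1 A (g z₀)) {f : E → F}
    (hf : ∀ᶠ x in 𝓝 (g z₀).1, HasFDerivAt f (A (x, f x)) x) (h₀ : (g z₀).2 = f (g z₀).1) :
    ∀ᶠ z in 𝓝 z₀, (g z).2 = f (g z).1 := by
  obtain ⟨K, s, hs, hlip⟩ := hA.exists_lipschitzOnWith
  have hgc : ContinuousAt g z₀ := hg.self_of_nhds.continuousAt
  have hg1c : ContinuousAt (fun z => (g z).1) z₀ := hgc.fst
  have hfc : ContinuousAt f (g z₀).1 := hf.self_of_nhds.continuousAt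
  have hfgc : ContinuousAt (fun z => ((g z).1, f (g z).1)) z₀ :=
    hg1c.prodMk (ContinuousAt.comp (f := fun z => (g z).1) hfc hg1c)
  have e1 : ∀ᶠ z in 𝓝 z₀, g z ∈ s := hgc hs
  have e2 : ∀ᶠ z in 𝓝 z₀, ((g z).1, f (g z).1) ∈ s := by
    refine hfgc (?_ : s ∈ 𝓝 ((g z₀).1, f (g z₀).1))
    rw [← h₀]
    exact hs
  have e3 : ∀ᶠ z in 𝓝 z₀, ‖g' z‖ < ‖g' z₀‖ + 1 :=
    eventually_norm_lt hg'
  have e4 : ∀ᶠ z in 𝓝 z₀, HasFDerivAt f (A ((g z).1, f (g z).1)) (g z).1 := hg1c.eventually hf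
  obtain ⟨ε, hε, hball⟩ := Metric.eventually_nhds_iff_ball.1
    ((hg.and htan).and ((e1.and e2).and (e3.and e4)))
  set C := ‖g' z₀‖ + 1 with hC
  filter_upwards [ball_mem_nhds z₀ hε] with z hz
  set γ : ℝ → H := fun t => z₀ + t • (z - z₀) with hγ
  have hγmem : ∀ t ∈ Icc (0 : ℝ) 1, γ t ∈ ball z₀ ε := by
    intro t ht
    rw [mem_ball, dist_eq_norm] at hz ⊢
    simp only [hγ, add_sub_cancel_left, norm_smul, Real.norm_eq_abs, abs_of_nonneg ht.1]
    exact (mul_le_of_le_one_left (norm_nonneg _) ht.2).trans_lt hz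
  have hγder : ∀ t, HasDerivAt γ (z - z₀) t := fun t => by
    simpa [hγ] using ((hasDerivAt_id t).smul_const (z - z₀)).const_add z₀
  set η : ℝ → F := fun t => (g (γ t)).2 - f (g (γ t)).1 with hη
  have hηder : ∀ t ∈ Icc (0 : ℝ) 1, HasDerivAt η
      ((A (g (γ t)) - A ((g (γ t)).1, f (g (γ t)).1)) (g' (γ t) (z - z₀)).1) t := by
    intro t ht
    obtain ⟨⟨b1, b2⟩, ⟨b3, b4⟩, b5, b6⟩ := hball _ (hγmem t ht)
    have d1 : HasDerivAt (fun t => g (γ t)) (g' (γ t) (z - z₀)) t :=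
      b1.comp_hasDerivAt t (hγder t)
    have d2 : HasDerivAt (fun t => (g (γ t)).1) (g' (γ t) (z - z₀)).1 t := by
      have := (ContinuousLinearMap.fst ℝ E F).hasFDerivAt.comp_hasDerivAt t d1
      exact this
    have d3 : HasDerivAt (fun t => (g (γ t)).2) (g' (γ t) (z - z₀)).2 t := by
      have := (ContinuousLinearMap.snd ℝ E F).hasFDerivAt.comp_hasDerivAt t d1
      exact this
    have d4 := d3.sub (b6.comp_hasDerivAt t d2)
    rw [b2] at d4
    exact d4
  have hzero := eq_zero_of_abs_deriv_le_mul_abs_self_of_eq_zero_right (f := η)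
    (K := K * (C * ‖z - z₀‖)) (a := 0) (b := 1)
    (fun t ht => (hηder t ht).continuousAt.continuousWithinAt)
    (fun t ht => (hηder t (Ico_subset_Icc_self ht)).hasDerivWithinAt)
    (by simp [hη, hγ, h₀])
    (fun t ht => by
      obtain ⟨-, ⟨b3, b4⟩, b5, -⟩ := hball _ (hγmem t (Ico_subset_Icc_self ht))
      refine (ContinuousLinearMap.le_opNorm _ _).trans ?_
      have l1 := hlip.dist_le_mul _ b3 _ b4
      rw [dist_eq_norm, dist_eq_norm] at l1
      have l2 : ‖g (γ t) - ((g (γ t)).1, f (g (γ t)).1)‖ = ‖η t‖ := by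
        rw [Prod.norm_def]
        simp [hη]
      rw [l2] at l1
      have l3 : ‖(g' (γ t) (z - z₀)).1‖ ≤ C * ‖z - z₀‖ :=
        (norm_fst_le _).trans ((ContinuousLinearMap.le_opNorm _ _).trans (by gcongr))
      calc _ ≤ (K * ‖η t‖) * (C * ‖z - z₀‖) := by gcongr
        _ = _ := by ring) 1 (by simp)
  have : γ 1 = z := by simp [hγ]
  rw [hη] at hzero
  simp only [this] at hzero
  exact sub_eq_zero.1 hzero

/-- Two solutions of a total differential equation on a connected open set agree if they agree at
one point. -/
theorem total_solution_unique {A : E × F → E →L[ℝ] F} {Ω : Set (E × F)} (hΩ : IsOpen Ω)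
    (hA : ContDiffOn ℝ 1 A Ω) {V : Set E} (hV : IsOpen V) (hVc : IsPreconnected V) {f₁ f₂ : E → F}
    (h₁ : ∀ x ∈ V, (x, f₁ x) ∈ Ω ∧ HasFDerivAt f₁ (A (x, f₁ x)) x)
    (h₂ : ∀ x ∈ V, (x, f₂ x) ∈ Ω ∧ HasFDerivAt f₂ (A (x, f₂ x)) x)
    {x₁ : E} (hx₁ : x₁ ∈ V) (h : f₁ x₁ = f₂ x₁) : EqOn f₁ f₂ V := by
  have hc₁ : ContinuousOn f₁ V := fun x hx => (h₁ x hx).2.continuousAt.continuousWithinAt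
  have hc₂ : ContinuousOn f₂ V := fun x hx => (h₂ x hx).2.continuousAt.continuousWithinAt
  have hu : IsOpen {x | x ∈ V ∧ f₁ x = f₂ x} := by
    rw [isOpen_iff_mem_nhds]
    rintro x ⟨hx, hxe⟩
    have hAx : ContDiffAt ℝ 1 A (x, f₁ x) := hA.contDiffAt (hΩ.mem_nhds (h₁ x hx).1)
    have hAc : ContinuousAt (fun x => A (x, f₁ x)) x :=
      ContinuousAt.comp (f := fun x => (x, f₁ x)) hAx.continuousAt
        (continuousAt_id.prodMk (h₁ x hx).2.continuousAt)
    have := eventually_snd_eq_of_tangent (A := A) (g := fun x => (x, f₁ x)) (f := f₂) (z₀ := x)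
      (g' := fun x => (ContinuousLinearMap.id ℝ E).prod (A (x, f₁ x)))
      ((hV.eventually_mem hx).mono fun y hy => (hasFDerivAt_id y).prodMk (h₁ y hy).2)
      ((ContinuousLinearMap.prodₗᵢ (𝕜 := ℝ) (E := E) (F := E) (G := F)
        ℝ).continuous.continuousAt.comp (continuousAt_const.prodMk hAc))
      (Eventually.of_forall fun y w => rfl) hAx
      ((hV.eventually_mem hx).mono fun y hy => (h₂ y hy).2) hxe
    filter_upwards [this, hV.mem_nhds hx] with y hy hyV
    exact ⟨hyV, hy⟩
  have hv : IsOpen {x | x ∈ V ∧ f₁ x ≠ f₂ x} := by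
    have := (hc₁.prodMk hc₂).isOpen_inter_preimage hV (isClosed_diagonal (X := F)).isOpen_compl
    exact this
  have := hVc.subset_left_of_subset_union hu hv
    (by rw [Set.disjoint_left]; rintro x ⟨-, hx⟩ ⟨-, hx'⟩; exact hx' hx)
    (fun x hx => by by_cases hxe : f₁ x = f₂ x; exacts [Or.inl ⟨hx, hxe⟩, Or.inr ⟨hx, hxe⟩])
    ⟨x₁, hx₁, hx₁, h⟩
  exact fun x hx => (this hx).2

/-- A curve satisfying a linear differential inequality vanishes identically as soon as it
vanishes once. -/
theorem eq_zero_of_norm_deriv_le {f f' : ℝ → E} {K a b : ℝ}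
    (hf : ∀ t ∈ Ioo a b, HasDerivAt f (f' t) t) (hK : ∀ t ∈ Ioo a b, ‖f' t‖ ≤ K * ‖f t‖)
    {s t : ℝ} (hs : s ∈ Ioo a b) (ht : t ∈ Ioo a b) (h : f s = 0) : f t = 0 := by
  rcases le_total s t with hst | hst
  · have hsub : Icc s t ⊆ Ioo a b := Icc_subset_Ioo hs.1 ht.2
    exact eq_zero_of_abs_deriv_le_mul_abs_self_of_eq_zero_right (f := f) (f' := f') (K := K)
      (fun x hx => (hf x (hsub hx)).continuousAt.continuousWithinAt)
      (fun x hx => (hf x (hsub (Ico_subset_Icc_self hx))).hasDerivWithinAt) h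
      (fun x hx => hK x (hsub (Ico_subset_Icc_self hx))) t ⟨hst, le_rfl⟩
  · have hsub : ∀ x ∈ Icc (-s) (-t), -x ∈ Ioo a b := fun x hx =>
      Icc_subset_Ioo ht.1 hs.2 ⟨by linarith [hx.2], by linarith [hx.1]⟩
    have hder : ∀ x ∈ Icc (-s) (-t), HasDerivAt (fun x => f (-x)) (-f' (-x)) x := by
      intro x hx
      have := (hf (-x) (hsub x hx)).scomp x (hasDerivAt_neg x)
      rw [neg_one_smul] at this
      exact this
    have := eq_zero_of_abs_deriv_le_mul_abs_self_of_eq_zero_right (f := fun x => f (-x))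
      (f' := fun x => -f' (-x)) (K := K)
      (fun x hx => (hder x hx).continuousAt.continuousWithinAt)
      (fun x hx => (hder x (Ico_subset_Icc_self hx)).hasDerivWithinAt) (by simpa using h)
      (fun x hx => by rw [norm_neg]; exact hK _ (hsub x (Ico_subset_Icc_self hx))) (-t)
      ⟨by linarith, le_rfl⟩
    simpa using this

end TotalDifferentialEquation

/-! ### Vector fields in smooth coordinates -/

section Coordinates

variable {d : ℕ} {M : Type u} [TopologicalSpace M]
  [ChartedSpace (EuclideanSpace ℝ (Fin d)) M]
  {V : Type*} [NormedAddCommGroup V] [NormedSpace ℝ V]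

/-- Smooth local coordinates on `M` with values in an arbitrary normed space `V`, which need not be
the model space of `M`. -/
structure IsSmoothCoordinate (d : ℕ) {M : Type u} [TopologicalSpace M]
    [ChartedSpace (EuclideanSpace ℝ (Fin d)) M] {V : Type*} [NormedAddCommGroup V] [NormedSpace ℝ V]
    (κ : OpenPartialHomeomorph M V) : Prop where
  contMDiffOn : ContMDiffOn (𝓡 d) 𝓘(ℝ, V) ∞ κ κ.source
  contMDiffOn_symm : ContMDiffOn 𝓘(ℝ, V) (𝓡 d) ∞ κ.symm κ.target

/-- The expression of the vector field `X` in the coordinates `κ`. -/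
noncomputable def fieldRep (κ : OpenPartialHomeomorph M V) (X : ∀ x : M, TangentSpace (𝓡 d) x) :
    V → V :=
  VectorField.mpullback 𝓘(ℝ, V) (𝓡 d) κ.symm X

/-- The derivative of the coordinates `κ` at `x`, with target the vector space `V` itself. -/
noncomputable def coordDeriv (d : ℕ) {M : Type u} [TopologicalSpace M]
    [ChartedSpace (EuclideanSpace ℝ (Fin d)) M] {V : Type*} [NormedAddCommGroup V] [NormedSpace ℝ V]
    (κ : OpenPartialHomeomorph M V) (x : M) :
    TangentSpace (𝓡 d) x →L[ℝ] V :=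
  mfderiv (𝓡 d) 𝓘(ℝ, V) κ x

/-- The derivative of the inverse of the coordinates `κ` at `z`, with source the vector space `V`
itself. -/
noncomputable def coordFrame (d : ℕ) {M : Type u} [TopologicalSpace M]
    [ChartedSpace (EuclideanSpace ℝ (Fin d)) M] {V : Type*} [NormedAddCommGroup V] [NormedSpace ℝ V]
    (κ : OpenPartialHomeomorph M V) (z : V) :
    V →L[ℝ] TangentSpace (𝓡 d) (κ.symm z) :=
  mfderiv 𝓘(ℝ, V) (𝓡 d) κ.symm z

namespace IsSmoothCoordinate

variable {κ : OpenPartialHomeomorph M V}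

theorem of_mem_maximalAtlas [IsManifold (𝓡 d) ∞ M]
    {e : OpenPartialHomeomorph M (EuclideanSpace ℝ (Fin d))}
    (he : e ∈ IsManifold.maximalAtlas (𝓡 d) ∞ M) : IsSmoothCoordinate d e :=
  ⟨contMDiffOn_of_mem_maximalAtlas he, contMDiffOn_symm_of_mem_maximalAtlas he⟩

theorem mem_maximalAtlas [IsManifold (𝓡 d) ∞ M]
    {e : OpenPartialHomeomorph M (EuclideanSpace ℝ (Fin d))} (he : IsSmoothCoordinate d e) :
    e ∈ IsManifold.maximalAtlas (𝓡 d) ∞ M :=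
  e.mem_maximalAtlas_of_contMDiffOn he.contMDiffOn he.contMDiffOn_symm

theorem trans {W : Type*} [NormedAddCommGroup W] [NormedSpace ℝ W] (hκ : IsSmoothCoordinate d κ)
    {e : OpenPartialHomeomorph V W} (he : ContDiffOn ℝ ∞ e e.source)
    (he' : ContDiffOn ℝ ∞ e.symm e.target) : IsSmoothCoordinate d (κ.trans e) where
  contMDiffOn := by
    rw [OpenPartialHomeomorph.trans_source]
    exact he.contMDiffOn.comp (hκ.contMDiffOn.mono fun x hx => hx.1) fun x hx => hx.2
  contMDiffOn_symm := by
    rw [OpenPartialHomeomorph.trans_target]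
    exact hκ.contMDiffOn_symm.comp (he'.contMDiffOn.mono fun x hx => hx.1) fun x hx => hx.2

variable (hκ : IsSmoothCoordinate d κ)
include hκ

theorem mdifferentiable : κ.MDifferentiable (𝓡 d) 𝓘(ℝ, V) :=
  ⟨hκ.contMDiffOn.mdifferentiableOn (by simp), hκ.contMDiffOn_symm.mdifferentiableOn (by simp)⟩

theorem contMDiffAt {x : M} (hx : x ∈ κ.source) : ContMDiffAt (𝓡 d) 𝓘(ℝ, V) ∞ κ x :=
  hκ.contMDiffOn.contMDiffAt (κ.open_source.mem_nhds hx)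

theorem contMDiffAt_symm {z : V} (hz : z ∈ κ.target) :
    ContMDiffAt 𝓘(ℝ, V) (𝓡 d) ∞ κ.symm z :=
  hκ.contMDiffOn_symm.contMDiffAt (κ.open_target.mem_nhds hz)

theorem isInvertible_mfderiv_symm {z : V} (hz : z ∈ κ.target) :
    (mfderiv 𝓘(ℝ, V) (𝓡 d) κ.symm z).IsInvertible :=
  ⟨hκ.mdifferentiable.symm.mfderiv hz, rfl⟩

theorem isInvertible_mfderiv {x : M} (hx : x ∈ κ.source) :
    (mfderiv (𝓡 d) 𝓘(ℝ, V) κ x).IsInvertible :=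
  ⟨hκ.mdifferentiable.mfderiv hx, rfl⟩

theorem coordFrame_coordDeriv {z : V} (hz : z ∈ κ.target)
    (v : TangentSpace (𝓡 d) (κ.symm z)) : coordFrame d κ z (coordDeriv d κ (κ.symm z) v) = v := by
  have h := hκ.mdifferentiable.symm_comp_deriv (κ.map_target hz)
  rw [κ.right_inv hz] at h
  exact congr($h v)

theorem coordDeriv_coordFrame {z : V} (hz : z ∈ κ.target) (w : V) :
    coordDeriv d κ (κ.symm z) (coordFrame d κ z w) = w :=
  congr($(hκ.mdifferentiable.comp_symm_deriv hz) w)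

theorem coordFrame_fieldRep {z : V} (hz : z ∈ κ.target) (X : ∀ x : M, TangentSpace (𝓡 d) x) :
    coordFrame d κ z (fieldRep κ X z) = X (κ.symm z) :=
  (hκ.isInvertible_mfderiv_symm hz).self_apply_inverse (X (κ.symm z))

theorem fieldRep_eq_coordDeriv {z : V} (hz : z ∈ κ.target) (X : ∀ x : M, TangentSpace (𝓡 d) x) :
    fieldRep κ X z = coordDeriv d κ (κ.symm z) (X (κ.symm z)) := by
  rw [← hκ.coordFrame_fieldRep hz X, hκ.coordDeriv_coordFrame hz]

theorem contDiffOn_fieldRep [IsManifold (𝓡 d) ∞ M] [CompleteSpace V]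
    {X : ∀ x : M, TangentSpace (𝓡 d) x} {U : Set M} (hU : IsOpen U)
    (hX : SmoothVectorFieldOn X U) :
    ContDiffOn ℝ ∞ (fieldRep κ X) (κ.target ∩ κ.symm ⁻¹' U) := by
  intro z hz
  have hXz := hX.contMDiffAt (hU.mem_nhds hz.2)
  have h := ContMDiffAt.mpullback_vectorField_preimage (I := 𝓘(ℝ, V)) (V := X) (m := ∞) (n := ∞)
    hXz (hκ.contMDiffAt_symm hz.1) (hκ.isInvertible_mfderiv_symm hz.1) (by simp)
  exact (contMDiffAt_vectorSpace_iff_contDiffAt.1 h).contDiffWithinAt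

theorem fieldRep_mlieBracket [IsManifold (𝓡 d) ∞ M] [CompleteSpace V]
    {X Y : ∀ x : M, TangentSpace (𝓡 d) x} {U : Set M} (hU : IsOpen U)
    (hX : SmoothVectorFieldOn X U) (hY : SmoothVectorFieldOn Y U) {z : V} (hz : z ∈ κ.target)
    (hzU : κ.symm z ∈ U) :
    fieldRep κ (VectorField.mlieBracket (𝓡 d) X Y) z =
      VectorField.lieBracket ℝ (fieldRep κ X) (fieldRep κ Y) z := by
  have hXz := (hX.contMDiffAt (hU.mem_nhds hzU)).mdifferentiableAt (by simp)
  have hYz := (hY.contMDiffAt (hU.mem_nhds hzU)).mdifferentiableAt (by simp)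
  have h2 : minSmoothness ℝ 2 ≤ ∞ := by rw [minSmoothness_of_isRCLikeNormedField]; decide
  have : IsManifold (𝓡 d) (minSmoothness ℝ 2) M := IsManifold.of_le h2
  have h1 := VectorField.mpullback_mlieBracket (I := 𝓘(ℝ, V)) hXz hYz (hκ.contMDiffAt_symm hz) h2
  rw [fieldRep, h1, ← VectorField.mlieBracketWithin_univ,
    VectorField.mlieBracketWithin_eq_lieBracketWithin]
  exact congrFun VectorField.lieBracketWithin_univ z

/-- A smooth vector field given in coordinates extends, after shrinking its domain, to a global
smooth vector field, by multiplication with a bump function. -/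
theorem exists_global_extension [IsManifold (𝓡 d) ∞ M] [T2Space M] [CompleteSpace V] {W : V → V}
    (hW : ContDiffOn ℝ ∞ W κ.target) {x : M} (hx : x ∈ κ.source) :
    ∃ X : ∀ x : M, TangentSpace (𝓡 d) x, SmoothVectorFieldOn X univ ∧
      (∀ᶠ z in 𝓝 (κ x), fieldRep κ X z = W z) ∧
      (∀ y, y ∉ κ.source → X y = 0) ∧
      ∀ z ∈ κ.target, ∃ c : ℝ,
        X (κ.symm z) = c • coordFrame d κ z (W z) := by
  obtain ⟨ψ, -, hψ⟩ := (SmoothBumpFunction.nhds_basis_tsupport (I := 𝓡 d) x).mem_iff.1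
    (κ.open_source.mem_nhds hx)
  set X₀ : ∀ y : M, TangentSpace (𝓡 d) y := VectorField.mpullback (𝓡 d) 𝓘(ℝ, V) κ W with hX₀def
  have hX₀ : ContMDiffOn (𝓡 d) (𝓡 d).tangent ∞
      (fun y => (⟨y, X₀ y⟩ : TangentBundle (𝓡 d) M)) κ.source := by
    intro y hy
    have hWy : ContMDiffAt 𝓘(ℝ, V) 𝓘(ℝ, V).tangent ∞
        (fun z => (⟨z, W z⟩ : TangentBundle 𝓘(ℝ, V) V)) (κ y) :=
      contMDiffAt_vectorSpace_iff_contDiffAt.2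
        (hW.contDiffAt (κ.open_target.mem_nhds (κ.map_source hy)))
    exact (ContMDiffAt.mpullback_vectorField_preimage (I := 𝓡 d) (m := ∞) (n := ∞) hWy
      (hκ.contMDiffAt hy) (hκ.isInvertible_mfderiv hy) (by simp)).contMDiffWithinAt
  have hX₀W : ∀ z ∈ κ.target, X₀ (κ.symm z) = coordFrame d κ z (W z) := by
    intro z hz
    have h1 : coordDeriv d κ (κ.symm z) (X₀ (κ.symm z)) = W (κ (κ.symm z)) :=
      (hκ.isInvertible_mfderiv (κ.map_target hz)).self_apply_inverse (W (κ (κ.symm z)))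
    rw [← hκ.coordFrame_coordDeriv hz (X₀ (κ.symm z)), h1, κ.right_inv hz]
  refine ⟨fun y => ψ y • X₀ y, ?_, ?_, ?_, ?_⟩
  · have := ContMDiffOn.smul_section_of_tsupport (ψ.contMDiff.contMDiffOn) κ.open_source hψ hX₀
    exact this.contMDiffOn
  · have h1 : ∀ᶠ y in 𝓝 (κ.symm (κ x)), ψ y = 1 := by
      rw [κ.left_inv hx]
      exact ψ.eventuallyEq_one
    filter_upwards [(κ.continuousAt_symm (κ.map_source hx)).eventually h1,
      κ.open_target.mem_nhds (κ.map_source hx)] with z hz hzt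
    rw [hκ.fieldRep_eq_coordDeriv hzt]
    simp only [hz, one_smul]
    rw [hX₀W z hzt, hκ.coordDeriv_coordFrame hzt]
  · intro y hy
    have : ψ y = 0 := image_eq_zero_of_notMem_tsupport fun h => hy (hψ h)
    simp [this]
  · intro z hz
    exact ⟨ψ (κ.symm z), congrArg _ (hX₀W z hz)⟩

end IsSmoothCoordinate

end Coordinates

section Coordinates

variable {d : ℕ} {M : Type u} [TopologicalSpace M]
  [ChartedSpace (EuclideanSpace ℝ (Fin d)) M]
  {V : Type*} [NormedAddCommGroup V] [NormedSpace ℝ V]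

theorem IsSmoothCoordinate.coordFrame_trans {κ : OpenPartialHomeomorph M V}
    (hκ : IsSmoothCoordinate d κ) {W : Type*} [NormedAddCommGroup W] [NormedSpace ℝ W]
    (e : OpenPartialHomeomorph V W) {z : W} (hz : z ∈ (κ.trans e).target)
    (he : DifferentiableAt ℝ e.symm z) (w : W) :
    coordFrame d (κ.trans e) z w = coordFrame d κ (e.symm z) (fderiv ℝ e.symm z w) := by
  rw [OpenPartialHomeomorph.trans_target] at hz
  have h := mfderiv_comp (I := 𝓘(ℝ, W)) (I' := 𝓘(ℝ, V)) (I'' := 𝓡 d) (f := e.symm) (g := κ.symm) z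
    ((hκ.contMDiffAt_symm hz.2).mdifferentiableAt (by simp)) he.mdifferentiableAt
  rw [mfderiv_eq_fderiv] at h
  exact congr($h w)

end Coordinates

/-! ### Coordinates in which a distribution is a field of graphs -/

section Graph

theorem ContDiffAt.clm_inverse {X E F : Type*} [NormedAddCommGroup X] [NormedSpace ℝ X]
    [NormedAddCommGroup E] [NormedSpace ℝ E] [NormedAddCommGroup F] [NormedSpace ℝ F]
    [CompleteSpace E] {n : WithTop ℕ∞} {P : X → E →L[ℝ] F} {x : X} (hP : ContDiffAt ℝ n P x)
    (hx : (P x).IsInvertible) : ContDiffAt ℝ n (fun y => (P y).inverse) x := by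
  obtain ⟨L, hL⟩ := hx
  have h := contDiffAt_map_inverse (𝕜 := ℝ) (n := n) L
  rw [hL] at h
  exact h.comp x hP

/-- A subspace of the right dimension is the first factor of a linear product decomposition. -/
theorem exists_continuousLinearEquiv_prod {m n : ℕ}
    (S : Submodule ℝ (EuclideanSpace ℝ (Fin (m + n)))) (hS : Module.finrank ℝ S = m) :
    ∃ L : EuclideanSpace ℝ (Fin (m + n)) ≃L[ℝ]
      EuclideanSpace ℝ (Fin m) × EuclideanSpace ℝ (Fin n), ∀ v ∈ S, (L v).2 = 0 := by
  obtain ⟨S', hS'⟩ := S.exists_isCompl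
  have hS'm : Module.finrank ℝ S' = n := by
    have := Submodule.finrank_add_eq_of_isCompl hS'
    rw [hS, finrank_euclideanSpace_fin] at this
    omega
  let L₁ : S ≃ₗ[ℝ] EuclideanSpace ℝ (Fin m) := LinearEquiv.ofFinrankEq _ _ (by simp [hS])
  let L₂ : S' ≃ₗ[ℝ] EuclideanSpace ℝ (Fin n) := LinearEquiv.ofFinrankEq _ _ (by simp [hS'm])
  refine ⟨((Submodule.prodEquivOfIsCompl S S' hS').symm.trans
    (L₁.prodCongr L₂)).toContinuousLinearEquiv, fun v hv => ?_⟩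
  have : (Submodule.prodEquivOfIsCompl S S' hS').symm v = (⟨v, hv⟩, 0) :=
    Submodule.prodEquivOfIsCompl_symm_apply_left S S' hS' ⟨v, hv⟩
  simp [this]

namespace SmoothDistribution

variable {m n : ℕ} {M : Type u} [TopologicalSpace M]
  [ChartedSpace (EuclideanSpace ℝ (Fin (m + n))) M] [IsManifold (𝓡 (m + n)) ∞ M]

/-- In the coordinates `κ` with values in `ℝᵐ × ℝⁿ`, the distribution `D` is at every point `z` the
graph of the linear map `A z`. -/
def IsGraphIn (D : SmoothDistribution m (m + n) M)
    (κ : OpenPartialHomeomorph M (EuclideanSpace ℝ (Fin m) × EuclideanSpace ℝ (Fin n)))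
    (A : EuclideanSpace ℝ (Fin m) × EuclideanSpace ℝ (Fin n) →
      EuclideanSpace ℝ (Fin m) →L[ℝ] EuclideanSpace ℝ (Fin n)) : Prop :=
  ∀ z ∈ κ.target, ∀ w, coordFrame (m + n) κ z w ∈ D.space (κ.symm z) ↔ w.2 = A z w.1

/-- Around every point there are coordinates in which the distribution is a field of graphs with
smooth slope. -/
theorem exists_isGraphIn (D : SmoothDistribution m (m + n) M) (x : M) :
    ∃ (κ : OpenPartialHomeomorph M (EuclideanSpace ℝ (Fin m) × EuclideanSpace ℝ (Fin n)))
      (A : EuclideanSpace ℝ (Fin m) × EuclideanSpace ℝ (Fin n) →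
        EuclideanSpace ℝ (Fin m) →L[ℝ] EuclideanSpace ℝ (Fin n)),
      IsSmoothCoordinate (m + n) κ ∧ x ∈ κ.source ∧ ContDiffOn ℝ ∞ A κ.target ∧
        D.IsGraphIn κ A := by
  obtain ⟨U, hU, hxU, X, hX, hspan⟩ := D.smooth x
  set G := EuclideanSpace ℝ (Fin (m + n)) with hG
  set E := EuclideanSpace ℝ (Fin m) with hE
  set F := EuclideanSpace ℝ (Fin n) with hF
  set e₀ : OpenPartialHomeomorph M G := chartAt G x with he₀def
  have he₀ : IsSmoothCoordinate (m + n) e₀ :=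
    .of_mem_maximalAtlas (IsManifold.chart_mem_maximalAtlas x)
  have hxe₀ : x ∈ e₀.source := mem_chart_source G x
  set Ω := e₀.target ∩ e₀.symm ⁻¹' U with hΩdef
  have hΩ : IsOpen Ω := e₀.symm.isOpen_inter_preimage hU
  have hzΩ : e₀ x ∈ Ω := ⟨e₀.map_source hxe₀, by simpa [e₀.left_inv hxe₀] using hxU⟩
  set Y : Fin m → G → G := fun i => fieldRep e₀ (X i) with hY
  have hYs : ∀ i, ContDiffOn ℝ ∞ (Y i) Ω := fun i => he₀.contDiffOn_fieldRep hU (hX i)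
  -- in coordinates, the distribution is the range of `P z`
  set P : G → E →L[ℝ] G := fun z => ∑ i, (EuclideanSpace.proj (𝕜 := ℝ) i).smulRight (Y i z) with hP
  have hPs : ContDiffOn ℝ ∞ P Ω := by
    refine ContDiffOn.sum fun i _ => ?_
    exact (ContinuousLinearMap.smulRightL ℝ E G (EuclideanSpace.proj i)).contDiff.comp_contDiffOn
      (hYs i)
  have hPapply : ∀ z a, P z a = ∑ i, a i • Y i z := fun z a => by
    simp only [hP, sum_apply, ContinuousLinearMap.smulRight_apply]
    rfl
  have hPspan : ∀ z v, v ∈ Submodule.span ℝ (range fun i => Y i z) ↔ ∃ a, P z a = v := by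
    intro z v
    rw [Submodule.mem_span_range_iff_exists_fun]
    constructor
    · rintro ⟨c, hc⟩
      exact ⟨WithLp.toLp 2 c, by rw [hPapply]; exact hc⟩
    · rintro ⟨a, ha⟩
      exact ⟨a, by rw [← ha, hPapply]⟩
  have hinj : ∀ z ∈ Ω, Function.Injective (coordFrame (m + n) e₀ z) := fun z hz v w hvw => by
    rw [← he₀.coordDeriv_coordFrame hz.1 v, hvw, he₀.coordDeriv_coordFrame hz.1 w]
  have hmap : ∀ z ∈ Ω, D.space (e₀.symm z) =
      (Submodule.span ℝ (range fun i => Y i z)).map (coordFrame (m + n) e₀ z).toLinearMap := by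
    intro z hz
    rw [hspan _ hz.2, Submodule.map_span, ← range_comp]
    exact congrArg (Submodule.span ℝ) (congrArg range (funext fun i =>
      (he₀.coordFrame_fieldRep hz.1 (X i)).symm))
  have hmem : ∀ z ∈ Ω, ∀ v, coordFrame (m + n) e₀ z v ∈ D.space (e₀.symm z) ↔ ∃ a, P z a = v := by
    intro z hz v
    rw [← hPspan, hmap z hz]
    constructor
    · rintro ⟨w, hw, hwv⟩
      rwa [← hinj z hz hwv]
    · exact fun hv => ⟨v, hv, rfl⟩
  have hS : Module.finrank ℝ (Submodule.span ℝ (range fun i => Y i (e₀ x))) = m := by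
    have h1 := D.finrank_space (e₀.symm (e₀ x))
    rw [hmap _ hzΩ] at h1
    exact (Submodule.equivMapOfInjective (coordFrame (m + n) e₀ (e₀ x)).toLinearMap
      (hinj _ hzΩ) _).finrank_eq.trans h1
  obtain ⟨L, hL⟩ := exists_continuousLinearEquiv_prod _ hS
  set P₁ : G → E →L[ℝ] E := fun z =>
    (ContinuousLinearMap.fst ℝ E F).comp ((L : G →L[ℝ] E × F).comp (P z)) with hP₁
  set P₂ : G → E →L[ℝ] F := fun z =>
    (ContinuousLinearMap.snd ℝ E F).comp ((L : G →L[ℝ] E × F).comp (P z)) with hP₂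
  have hP₁s : ContDiffOn ℝ ∞ P₁ Ω := contDiffOn_const.clm_comp (contDiffOn_const.clm_comp hPs)
  have hP₂s : ContDiffOn ℝ ∞ P₂ Ω := contDiffOn_const.clm_comp (contDiffOn_const.clm_comp hPs)
  have hPrange : (P (e₀ x)).toLinearMap.range = Submodule.span ℝ (range fun i => Y i (e₀ x)) := by
    ext v
    rw [hPspan]
    rfl
  have hPker : (P (e₀ x)).toLinearMap.ker = ⊥ := by
    have h1 := LinearMap.finrank_range_add_finrank_ker (P (e₀ x)).toLinearMap
    rw [hPrange, hS, finrank_euclideanSpace_fin] at h1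
    exact Submodule.finrank_eq_zero.1 (by omega)
  have hinv : (P₁ (e₀ x)).IsInvertible := by
    have h1 : Function.Injective (P₁ (e₀ x)).toLinearMap := by
      rw [injective_iff_map_eq_zero]
      intro a ha
      have h2 : (L (P (e₀ x) a)).2 = 0 := hL _ ((hPspan _ _).2 ⟨a, rfl⟩)
      have h3 : P (e₀ x) a = 0 := L.map_eq_zero_iff.1 (Prod.ext ha h2)
      exact (LinearMap.ker_eq_bot'.1 hPker) a h3
    refine ⟨(LinearEquiv.ofInjectiveEndo _ h1).toContinuousLinearEquiv, ?_⟩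
    ext a
    rfl
  set O := Ω ∩ P₁ ⁻¹' (range ((↑) : (E ≃L[ℝ] E) → E →L[ℝ] E)) with hOdef
  have hO : IsOpen O := hP₁s.continuousOn.isOpen_inter_preimage hΩ ContinuousLinearEquiv.isOpen
  set e : OpenPartialHomeomorph G (E × F) :=
    L.toHomeomorph.toOpenPartialHomeomorph.restrOpen O hO with he
  have hes : e.source = O := by simp [he]
  have het : ∀ z ∈ e.target, L.symm z ∈ O := fun z hz => by
    have := e.map_target hz
    rwa [hes] at this
  refine ⟨e₀.trans e, fun z => (P₂ (L.symm z)).comp (P₁ (L.symm z)).inverse, he₀.trans ?_ ?_,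
    ?_, ?_, ?_⟩
  · exact L.contDiff.contDiffOn
  · exact L.symm.contDiff.contDiffOn
  · rw [OpenPartialHomeomorph.trans_source, hes]
    exact ⟨hxe₀, hzΩ, hinv⟩
  · intro z hz
    rw [OpenPartialHomeomorph.trans_target] at hz
    have hzO := het z hz.1
    have h1 : ContDiffAt ℝ ∞ (fun z => P₂ (L.symm z)) z :=
      (hP₂s.contDiffAt (hΩ.mem_nhds hzO.1)).comp z L.symm.contDiff.contDiffAt
    have h2 : ContDiffAt ℝ ∞ (fun z => P₁ (L.symm z)) z :=
      (hP₁s.contDiffAt (hΩ.mem_nhds hzO.1)).comp z L.symm.contDiff.contDiffAt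
    exact (h1.clm_comp (h2.clm_inverse hzO.2)).contDiffWithinAt
  · intro z hz w
    have hz' := hz
    rw [OpenPartialHomeomorph.trans_target] at hz'
    have hzO := het z hz'.1
    have hd : fderiv ℝ e.symm z = L.symm := L.symm.fderiv
    rw [he₀.coordFrame_trans e hz L.symm.differentiableAt, hd]
    refine (hmem _ hzO.1 _).trans ?_
    obtain ⟨Q, hQ⟩ := hzO.2
    have hfst : ∀ a, (L (P (L.symm z) a)).1 = Q a := fun a => congr($hQ.symm a)
    have hsnd : ∀ a, (L (P (L.symm z) a)).2 = P₂ (L.symm z) a := fun a => rfl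
    change _ ↔ w.2 = P₂ (L.symm z) ((P₁ (L.symm z)).inverse w.1)
    rw [← hQ, ContinuousLinearMap.inverse_equiv]
    constructor
    · rintro ⟨a, ha⟩
      have hw : L (P (L.symm z) a) = w := by
        rw [ha]; exact L.apply_symm_apply w
      rw [← hw, hsnd]
      simp [hfst]
    · intro hw
      refine ⟨Q.symm w.1, ?_⟩
      apply L.injective
      have : L ((L.symm : E × F →L[ℝ] G) w) = w := L.apply_symm_apply w
      rw [this]
      refine Prod.ext ?_ ?_
      · rw [hfst]; simp
      · rw [hsnd, hw]; simp

end SmoothDistribution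

end Graph

namespace SmoothDistribution

variable {m n : ℕ} {M : Type u} [TopologicalSpace M]
  [ChartedSpace (EuclideanSpace ℝ (Fin (m + n))) M] [IsManifold (𝓡 (m + n)) ∞ M]

namespace IsGraphIn

variable {D : SmoothDistribution m (m + n) M}
  {κ : OpenPartialHomeomorph M (EuclideanSpace ℝ (Fin m) × EuclideanSpace ℝ (Fin n))}
  {A : EuclideanSpace ℝ (Fin m) × EuclideanSpace ℝ (Fin n) →
    EuclideanSpace ℝ (Fin m) →L[ℝ] EuclideanSpace ℝ (Fin n)}

theorem mem_space_iff (h : D.IsGraphIn κ A) (hκ : IsSmoothCoordinate (m + n) κ) {x : M}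
    (hx : x ∈ κ.source) (v : TangentSpace (𝓡 (m + n)) x) :
    v ∈ D.space x ↔ (coordDeriv (m + n) κ x v).2 = A (κ x) (coordDeriv (m + n) κ x v).1 := by
  have key : ∀ v : TangentSpace (𝓡 (m + n)) (κ.symm (κ x)), v ∈ D.space (κ.symm (κ x)) ↔
      (coordDeriv (m + n) κ (κ.symm (κ x)) v).2 =
        A (κ x) (coordDeriv (m + n) κ (κ.symm (κ x)) v).1 := fun v => by
    rw [← h _ (κ.map_source hx), hκ.coordFrame_coordDeriv (κ.map_source hx)]
  rw [κ.left_inv hx] at key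
  exact key v

theorem fieldRep_snd (h : D.IsGraphIn κ A) (hκ : IsSmoothCoordinate (m + n) κ)
    {X : ∀ x : M, TangentSpace (𝓡 (m + n)) x} (hX : D.IsSection X) {z} (hz : z ∈ κ.target) :
    (fieldRep κ X z).2 = A z (fieldRep κ X z).1 := by
  rw [← h z hz, hκ.coordFrame_fieldRep hz]
  exact hX.2 _

/-- Involutivity of `D` expressed through the slope `A`: for constant `a` and `b`, the bracket of
the sections `z ↦ (a, A z a)` and `z ↦ (b, A z b)` of `D` has vanishing first component, so its
second component vanishes too. -/
theorem integrability [T2Space M] (h : D.IsGraphIn κ A) (hκ : IsSmoothCoordinate (m + n) κ)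
    (hA : ContDiffOn ℝ ∞ A κ.target) (hD : D.IsInvolutive) {z} (hz : z ∈ κ.target)
    (a b : EuclideanSpace ℝ (Fin m)) :
    fderiv ℝ A z (a, A z a) b = fderiv ℝ A z (b, A z b) a := by
  set W : EuclideanSpace ℝ (Fin m) → EuclideanSpace ℝ (Fin m) × EuclideanSpace ℝ (Fin n) →
    EuclideanSpace ℝ (Fin m) × EuclideanSpace ℝ (Fin n) := fun a z => (a, A z a) with hWdef
  have hW : ∀ a, ContDiffOn ℝ ∞ (W a) κ.target := fun a =>
    contDiffOn_const.prodMk (hA.clm_apply contDiffOn_const)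
  have hWd : ∀ a w, fderiv ℝ (W a) z w = (0, fderiv ℝ A z w a) := by
    intro a w
    have h1 : HasFDerivAt A (fderiv ℝ A z) z :=
      ((hA.contDiffAt (κ.open_target.mem_nhds hz)).differentiableAt (by simp)).hasFDerivAt
    have h2 := (hasFDerivAt_const a z).prodMk (h1.clm_apply (hasFDerivAt_const a z))
    rw [show fderiv ℝ (W a) z = _ from h2.fderiv]
    simp
  have hext : ∀ a, ∃ X, D.IsSection X ∧ fieldRep κ X =ᶠ[𝓝 z] W a := by
    intro a
    obtain ⟨X, hX, hXW, hX0, hXt⟩ := hκ.exists_global_extension (hW a) (κ.map_target hz)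
    rw [κ.right_inv hz] at hXW
    refine ⟨X, ⟨hX, fun y => ?_⟩, hXW⟩
    by_cases hy : y ∈ κ.source
    · have key : ∀ z ∈ κ.target, X (κ.symm z) ∈ D.space (κ.symm z) := by
        intro z hz
        obtain ⟨c, hc⟩ := hXt z hz
        rw [hc]
        exact (D.space _).smul_mem c ((h z hz _).2 rfl)
      have := key (κ y) (κ.map_source hy)
      rwa [κ.left_inv hy] at this
    · rw [hX0 y hy]
      exact (D.space y).zero_mem
  obtain ⟨X, hX, hXW⟩ := hext a
  obtain ⟨Y, hY, hYW⟩ := hext b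
  have h1 := hD X Y hX hY (κ.symm z)
  rw [← hκ.coordFrame_fieldRep hz (VectorField.mlieBracket _ X Y), h z hz,
    hκ.fieldRep_mlieBracket isOpen_univ hX.1 hY.1 hz (mem_univ _),
    hXW.lieBracket_vectorField_eq hYW] at h1
  simp only [VectorField.lieBracket, hWd, Prod.mk_sub_mk, sub_zero, map_zero] at h1
  exact sub_eq_zero.1 h1

end IsGraphIn

end SmoothDistribution

/-! ### Immersions and integral manifolds -/

section Immersion

variable {d k : ℕ} {M : Type u} [TopologicalSpace M]
  [ChartedSpace (EuclideanSpace ℝ (Fin d)) M] [IsManifold (𝓡 d) ∞ M]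
  {N : Type u} [TopologicalSpace N] [ChartedSpace (EuclideanSpace ℝ (Fin k)) N]
  [IsManifold (𝓡 k) ∞ N]

/-- Local normal form of an immersion in adapted coordinates on both sides. -/
theorem Manifold.IsImmersion.exists_coordinates {ι : N → M}
    (h : Manifold.IsImmersion (𝓡 k) (𝓡 d) ∞ ι) (p : N) :
    ∃ (F : Type) (_ : NormedAddCommGroup F) (_ : NormedSpace ℝ F) (_ : FiniteDimensional ℝ F)
      (κ : OpenPartialHomeomorph M (EuclideanSpace ℝ (Fin k) × F))
      (ψ : OpenPartialHomeomorph N (EuclideanSpace ℝ (Fin k))),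
      IsSmoothCoordinate d κ ∧ IsSmoothCoordinate k ψ ∧ p ∈ ψ.source ∧
        ∀ q ∈ ψ.source, ι q ∈ κ.source ∧ κ (ι q) = (ψ q, 0) := by
  have hp := h.isImmersionAt p
  have : FiniteDimensional ℝ (EuclideanSpace ℝ (Fin k) × hp.complement) :=
    hp.equiv.symm.toLinearEquiv.finiteDimensional
  have hfd : FiniteDimensional ℝ hp.complement :=
    Module.Finite.of_surjective (LinearMap.snd ℝ (EuclideanSpace ℝ (Fin k)) hp.complement)
      LinearMap.snd_surjective
  have hcod := IsSmoothCoordinate.of_mem_maximalAtlas hp.codChart_mem_maximalAtlas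
  refine ⟨hp.complement, inferInstance, inferInstance, hfd,
    hp.codChart.trans hp.equiv.symm.toHomeomorph.toOpenPartialHomeomorph, hp.domChart,
    hcod.trans hp.equiv.symm.contDiff.contDiffOn hp.equiv.contDiff.contDiffOn,
    .of_mem_maximalAtlas hp.domChart_mem_maximalAtlas, hp.mem_domChart_source, fun q hq => ?_⟩
  have hq' : ι q ∈ hp.codChart.source := hp.source_subset_preimage_source hq
  refine ⟨by simpa using hq', ?_⟩
  have hqt : hp.domChart q ∈ (hp.domChart.extend (𝓡 k)).target := by
    simpa using hp.domChart.map_source hq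
  have h1 := hp.writtenInCharts hqt
  simp only [Function.comp_apply, OpenPartialHomeomorph.extend_coe,
    OpenPartialHomeomorph.extend_coe_symm, modelWithCornersSelf_coe, modelWithCornersSelf_coe_symm,
    id, hp.domChart.left_inv hq] at h1
  have h2 : hp.equiv.symm (hp.codChart (ι q)) = (hp.domChart q, 0) := by
    rw [h1]; exact hp.equiv.symm_apply_apply _
  exact h2

omit [IsManifold (𝓡 d) ∞ M] [IsManifold (𝓡 k) ∞ N] in
/-- Chain rule in coordinates: if `ι` is represented by `g`, then `mfderiv ι` is represented by the
derivative of `g`. -/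
theorem coordDeriv_mfderiv {V W : Type*} [NormedAddCommGroup V] [NormedSpace ℝ V]
    [NormedAddCommGroup W] [NormedSpace ℝ W] {κ : OpenPartialHomeomorph M V}
    {ψ : OpenPartialHomeomorph N W} (hκ : IsSmoothCoordinate d κ) (hψ : IsSmoothCoordinate k ψ)
    {ι : N → M} {q : N} (hι : MDifferentiableAt (𝓡 k) (𝓡 d) ι q) (hq : q ∈ ψ.source)
    (hqκ : ι q ∈ κ.source) {g : W → V} {g' : W →L[ℝ] V} (hg : HasFDerivAt g g' (ψ q))
    (h : ∀ᶠ q' in 𝓝 q, κ (ι q') = g (ψ q')) (v : TangentSpace (𝓡 k) q) :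
    coordDeriv d κ (ι q) (mfderiv (𝓡 k) (𝓡 d) ι q v) = g' (coordDeriv k ψ q v) := by
  have h1 := mfderiv_comp (I' := 𝓡 d) (I'' := 𝓘(ℝ, V)) q
    ((hκ.contMDiffAt hqκ).mdifferentiableAt (by simp)) hι
  have h2 := mfderiv_comp (I := 𝓡 k) (I' := 𝓘(ℝ, W)) (I'' := 𝓘(ℝ, V)) (f := ψ) (g := g) q
    hg.differentiableAt.mdifferentiableAt ((hψ.contMDiffAt hq).mdifferentiableAt (by simp))
  have h3 : κ ∘ ι =ᶠ[𝓝 q] g ∘ ψ := h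
  rw [mfderiv_eq_fderiv, hg.fderiv] at h2
  have h4 := h3.mfderiv_eq (I := 𝓡 k) (I' := 𝓘(ℝ, V))
  rw [h1, h2] at h4
  exact congr($h4 v)

omit [IsManifold (𝓡 d) ∞ M] [IsManifold (𝓡 k) ∞ N] in
theorem coordDeriv_mfderiv_of_eq {F : Type*} [NormedAddCommGroup F] [NormedSpace ℝ F]
    {κ : OpenPartialHomeomorph M (EuclideanSpace ℝ (Fin k) × F)}
    {ψ : OpenPartialHomeomorph N (EuclideanSpace ℝ (Fin k))} (hκ : IsSmoothCoordinate d κ)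
    (hψ : IsSmoothCoordinate k ψ) {ι : N → M} (hι : MDifferentiable (𝓡 k) (𝓡 d) ι)
    (h : ∀ q ∈ ψ.source, ι q ∈ κ.source ∧ κ (ι q) = (ψ q, 0)) {q : N} (hq : q ∈ ψ.source)
    (v : TangentSpace (𝓡 k) q) :
    coordDeriv d κ (ι q) (mfderiv (𝓡 k) (𝓡 d) ι q v) = (coordDeriv k ψ q v, 0) := by
  refine coordDeriv_mfderiv hκ hψ (hι q) hq (h q hq).1
    (ContinuousLinearMap.inl ℝ (EuclideanSpace ℝ (Fin k)) F).hasFDerivAt ?_ v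
  filter_upwards [ψ.open_source.mem_nhds hq] with q' hq'
  exact (h q' hq').2

omit [IsManifold (𝓡 d) ∞ M] [IsManifold (𝓡 k) ∞ N] in
theorem mem_range_mfderiv_iff {F : Type*} [NormedAddCommGroup F] [NormedSpace ℝ F]
    {κ : OpenPartialHomeomorph M (EuclideanSpace ℝ (Fin k) × F)}
    {ψ : OpenPartialHomeomorph N (EuclideanSpace ℝ (Fin k))} (hκ : IsSmoothCoordinate d κ)
    (hψ : IsSmoothCoordinate k ψ) {ι : N → M} (hι : MDifferentiable (𝓡 k) (𝓡 d) ι)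
    (h : ∀ q ∈ ψ.source, ι q ∈ κ.source ∧ κ (ι q) = (ψ q, 0)) {q : N} (hq : q ∈ ψ.source)
    (w : TangentSpace (𝓡 d) (ι q)) :
    w ∈ LinearMap.range (mfderiv (𝓡 k) (𝓡 d) ι q).toLinearMap ↔
      (coordDeriv d κ (ι q) w).2 = 0 := by
  constructor
  · rintro ⟨v, rfl⟩
    exact congrArg Prod.snd (coordDeriv_mfderiv_of_eq hκ hψ hι h hq v)
  · intro hw
    obtain ⟨v, hv⟩ := hψ.mdifferentiable.mfderiv_surjective hq (coordDeriv d κ (ι q) w).1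
    refine ⟨v, hκ.mdifferentiable.mfderiv_injective (h q hq).1 ?_⟩
    have h1 := coordDeriv_mfderiv_of_eq hκ hψ hι h hq v
    have h2 : (coordDeriv k ψ q v, (0 : F)) = coordDeriv d κ (ι q) w := Prod.ext hv hw.symm
    exact h1.trans h2

theorem Manifold.IsImmersion.mfderiv_injective {ι : N → M}
    (h : Manifold.IsImmersion (𝓡 k) (𝓡 d) ∞ ι) (p : N) :
    Function.Injective (mfderiv (𝓡 k) (𝓡 d) ι p) := by
  obtain ⟨F, _, _, _, κ, ψ, hκ, hψ, hp, hι⟩ := h.exists_coordinates p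
  intro v w hvw
  have h1 := coordDeriv_mfderiv_of_eq hκ hψ (h.contMDiff.mdifferentiable (by simp)) hι hp
  have h2 := congrArg Prod.fst ((h1 v).symm.trans ((congrArg _ hvw).trans (h1 w)))
  exact hψ.mdifferentiable.mfderiv_injective hp h2

theorem Manifold.IsImmersion.finrank_range_mfderiv {ι : N → M}
    (h : Manifold.IsImmersion (𝓡 k) (𝓡 d) ∞ ι) (p : N) :
    Module.finrank ℝ (LinearMap.range (mfderiv (𝓡 k) (𝓡 d) ι p).toLinearMap) = k := by
  rw [LinearMap.finrank_range_of_inj (h.mfderiv_injective p)]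
  exact finrank_euclideanSpace_fin

end Immersion

namespace SmoothDistribution

variable {m d k : ℕ} {M : Type u} [TopologicalSpace M]
  [ChartedSpace (EuclideanSpace ℝ (Fin d)) M] [IsManifold (𝓡 d) ∞ M]
  {N : Type u} [TopologicalSpace N]

instance (x : M) : FiniteDimensional ℝ (TangentSpace (𝓡 d) x) :=
  inferInstanceAs (FiniteDimensional ℝ (EuclideanSpace ℝ (Fin d)))

theorem IsIntegralManifold.le [ChartedSpace (EuclideanSpace ℝ (Fin k)) N] [IsManifold (𝓡 k) ∞ N]
    {D : SmoothDistribution m d M} {ι : N → M} (h : D.IsIntegralManifold k ι) (p : N) : k ≤ m := by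
  have := Submodule.finrank_mono (h.tangent_le p)
  rwa [h.immersion.finrank_range_mfderiv, D.finrank_space] at this

theorem IsIntegralManifold.range_eq [ChartedSpace (EuclideanSpace ℝ (Fin m)) N]
    [IsManifold (𝓡 m) ∞ N] {D : SmoothDistribution m d M} {ι : N → M}
    (h : D.IsIntegralManifold m ι) (p : N) :
    LinearMap.range (mfderiv (𝓡 m) (𝓡 d) ι p).toLinearMap = D.space (ι p) :=
  Submodule.eq_of_le_of_finrank_eq (h.tangent_le p)
    (by rw [h.immersion.finrank_range_mfderiv, D.finrank_space])

/-- Along an integral manifold of full dimension, the bracket of two sections of `D` lies in `D`: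
both sections are tangent to the integral manifold, which is a slice in suitable coordinates. -/
theorem IsIntegralManifold.mlieBracket_mem [ChartedSpace (EuclideanSpace ℝ (Fin m)) N]
    [IsManifold (𝓡 m) ∞ N] {D : SmoothDistribution m d M} {ι : N → M}
    (h : D.IsIntegralManifold m ι) {X Y : ∀ x : M, TangentSpace (𝓡 d) x} (hX : D.IsSection X)
    (hY : D.IsSection Y) (p : N) : VectorField.mlieBracket (𝓡 d) X Y (ι p) ∈ D.space (ι p) := by
  obtain ⟨F, _, _, _, κ, ψ, hκ, hψ, hp, hι⟩ := h.immersion.exists_coordinates p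
  have hmd := h.immersion.contMDiff.mdifferentiable (by simp)
  have hrep : ∀ (Z : ∀ x : M, TangentSpace (𝓡 d) x), ∀ q ∈ ψ.source,
      fieldRep κ Z (ψ q, 0) = coordDeriv d κ (ι q) (Z (ι q)) := by
    intro Z q hq
    have h1 := hκ.fieldRep_eq_coordDeriv (κ.map_source (hι q hq).1) Z
    rw [κ.left_inv (hι q hq).1, (hι q hq).2] at h1
    exact h1
  have htan : ∀ (Z : ∀ x : M, TangentSpace (𝓡 d) x), ∀ q ∈ ψ.source,
      Z (ι q) ∈ D.space (ι q) ↔ (fieldRep κ Z (ψ q, 0)).2 = 0 := by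
    intro Z q hq
    rw [hrep Z q hq, ← h.range_eq q]
    exact mem_range_mfderiv_iff hκ hψ hmd hι hq _
  have hz : (ψ p, 0) ∈ κ.target := (hι p hp).2 ▸ κ.map_source (hι p hp).1
  -- the transversal component of a section does not vary along the slice
  have hder : ∀ Z, D.IsSection Z → ∀ a, (fderiv ℝ (fieldRep κ Z) (ψ p, 0) (a, 0)).2 = 0 := by
    intro Z hZ a
    have h1 : HasFDerivAt (fieldRep κ Z) (fderiv ℝ (fieldRep κ Z) (ψ p, 0)) (ψ p, 0) := by
      have := hκ.contDiffOn_fieldRep isOpen_univ hZ.1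
      rw [preimage_univ, inter_univ] at this
      exact ((this.contDiffAt (κ.open_target.mem_nhds hz)).differentiableAt (by simp)).hasFDerivAt
    have h2 := ((ContinuousLinearMap.snd ℝ (EuclideanSpace ℝ (Fin m)) F).hasFDerivAt.comp _
      h1).comp (ψ p) (f := fun u => (u, (0 : F)))
        ((hasFDerivAt_id (ψ p)).prodMk (hasFDerivAt_const (0 : F) (ψ p)))
    have h3 : (fun u => (fieldRep κ Z (u, 0)).2) =ᶠ[𝓝 (ψ p)] fun _ => 0 := by
      filter_upwards [ψ.open_target.mem_nhds (ψ.map_source hp)] with u hu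
      have := (htan Z (ψ.symm u) (ψ.map_target hu)).1 (hZ.2 _)
      rwa [ψ.right_inv hu] at this
    have h4 := h2.unique ((hasFDerivAt_const (0 : F) (ψ p)).congr_of_eventuallyEq h3)
    exact congr($h4 a)
  rw [htan _ p hp]
  have hpt : κ.symm (ψ p, 0) ∈ univ := mem_univ _
  rw [hκ.fieldRep_mlieBracket isOpen_univ hX.1 hY.1 hz hpt]
  have hX0 : fieldRep κ X (ψ p, 0) = ((fieldRep κ X (ψ p, 0)).1, 0) :=
    Prod.ext rfl ((htan X p hp).1 (hX.2 _))
  have hY0 : fieldRep κ Y (ψ p, 0) = ((fieldRep κ Y (ψ p, 0)).1, 0) :=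
    Prod.ext rfl ((htan Y p hp).1 (hY.2 _))
  rw [VectorField.lieBracket, Prod.snd_sub, hX0, hY0, hder Y hY, hder X hX, sub_zero]

end SmoothDistribution

/-! ### Unions of graphs as integral manifolds -/

section Plaques

variable {E : Type} [NormedAddCommGroup E]

/-- The disjoint union of copies of the open set `V ⊆ E` indexed by `J`, where `J` is regarded as
discrete. The lift to the universe `u` makes it available as an integral manifold of a manifold in
that universe. -/
def Plaques (J : Type) (V : TopologicalSpace.Opens E) : Type u :=
  ULift.{u} (Σ _ : J, V)

namespace Plaques

variable {J : Type} {V : TopologicalSpace.Opens E}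

instance : TopologicalSpace (Plaques.{u} J V) :=
  inferInstanceAs (TopologicalSpace (ULift.{u} (Σ _ : J, V)))

instance [Countable J] [SecondCountableTopology E] : SecondCountableTopology (Plaques.{u} J V) :=
  (Homeomorph.ulift.{u} (X := Σ _ : J, V)).secondCountableTopology

/-- The index of the copy of `V` that contains `p`. -/
def idx (p : Plaques.{u} J V) : J := p.down.1

/-- The point of `V` underlying `p`. -/
def proj (p : Plaques.{u} J V) : E := p.down.2

theorem proj_mem (p : Plaques.{u} J V) : p.proj ∈ V := p.down.2.2

/-- The inclusion of the copy of `V` with index `j`. -/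
def incl (j : J) (x : V) : Plaques.{u} J V := ⟨⟨j, x⟩⟩

theorem isOpenEmbedding_incl (j : J) : Topology.IsOpenEmbedding (incl.{u} (V := V) j) :=
  (Homeomorph.ulift.{u} (X := Σ _ : J, V)).symm.isOpenEmbedding.comp
    Topology.IsOpenEmbedding.sigmaMk

theorem ext {p q : Plaques.{u} J V} (h : p.idx = q.idx) (h' : p.proj = q.proj) : p = q := by
  obtain ⟨⟨i, x⟩⟩ := p
  obtain ⟨⟨j, y⟩⟩ := q
  obtain rfl : i = j := h
  obtain rfl : x = y := Subtype.ext h'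
  rfl

/-- The projection to `V`, restricted to the copy of `V` that contains `p`, as a chart. -/
noncomputable def chart (p : Plaques.{u} J V) : OpenPartialHomeomorph (Plaques.{u} J V) E :=
  have : Nonempty V := ⟨p.down.2⟩
  ((isOpenEmbedding_incl.{u} (V := V) p.idx).toOpenPartialHomeomorph _).symm.trans
    (V.openPartialHomeomorphSubtypeCoe this)

theorem chart_source (p : Plaques.{u} J V) : p.chart.source = {q | q.idx = p.idx} := by
  ext q
  simp only [chart, OpenPartialHomeomorph.trans_source]
  simp
  constructor
  · rintro ⟨y, hy, rfl⟩
    rfl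
  · intro h
    exact ⟨q.proj, q.proj_mem, Plaques.ext h.symm rfl⟩

theorem chart_target (p : Plaques.{u} J V) : p.chart.target = V := by
  simp [chart]

theorem chart_symm_apply (p : Plaques.{u} J V) {x : E} (hx : x ∈ V) :
    p.chart.symm x = incl p.idx ⟨x, hx⟩ := by
  have : Nonempty V := ⟨p.down.2⟩
  have h : (V.openPartialHomeomorphSubtypeCoe this).symm x = ⟨x, hx⟩ :=
    (V.openPartialHomeomorphSubtypeCoe this).left_inv (x := ⟨x, hx⟩) (by simp)
  simp [chart, h]

theorem chart_apply (p : Plaques.{u} J V) {q : Plaques.{u} J V} (hq : q.idx = p.idx) :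
    p.chart q = q.proj := by
  have h : p.chart.symm q.proj = q := by
    rw [p.chart_symm_apply q.proj_mem]
    exact Plaques.ext hq.symm rfl
  rw [← congrArg p.chart h, p.chart.right_inv]
  rw [chart_target]
  exact q.proj_mem

noncomputable instance : ChartedSpace E (Plaques.{u} J V) where
  atlas := range chart
  chartAt := chart
  mem_chart_source p := by rw [chart_source]; rfl
  chart_mem_atlas p := mem_range_self p

instance [NormedSpace ℝ E] : IsManifold 𝓘(ℝ, E) ∞ (Plaques.{u} J V) := by
  refine isManifold_of_contDiffOn _ _ _ ?_
  rintro _ _ ⟨p, rfl⟩ ⟨q, rfl⟩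
  refine contDiffOn_id.congr fun x hx => ?_
  simp only [modelWithCornersSelf_coe, modelWithCornersSelf_coe_symm, preimage_id, range_id,
    inter_univ, OpenPartialHomeomorph.trans_source, OpenPartialHomeomorph.symm_source,
    chart_target, chart_source] at hx
  obtain ⟨hx, hx'⟩ := hx
  rw [mem_preimage, p.chart_symm_apply hx] at hx'
  simp only [modelWithCornersSelf_coe, modelWithCornersSelf_coe_symm, Function.comp_id, id,
    OpenPartialHomeomorph.coe_trans, Function.comp_apply, p.chart_symm_apply hx]
  exact q.chart_apply hx'

end Plaques

end Plaques

/-- The map `(x, y) ↦ (x, y - f x)` over the open set `V`, which straightens the graph of `f`. -/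
noncomputable def shear {E F : Type*} [NormedAddCommGroup E] [NormedAddCommGroup F]
    {V : Set E} (hV : IsOpen V) {f : E → F} (hf : ContinuousOn f V) :
    OpenPartialHomeomorph (E × F) (E × F) where
  toFun z := (z.1, z.2 - f z.1)
  invFun z := (z.1, z.2 + f z.1)
  source := V ×ˢ univ
  target := V ×ˢ univ
  map_source' _ hz := ⟨hz.1, mem_univ _⟩
  map_target' _ hz := ⟨hz.1, mem_univ _⟩
  left_inv' _ _ := by simp
  right_inv' _ _ := by simp
  open_source := hV.prod isOpen_univ
  open_target := hV.prod isOpen_univ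
  continuousOn_toFun := continuousOn_fst.prodMk
    (continuousOn_snd.sub (hf.comp continuousOn_fst fun _ hz => hz.1))
  continuousOn_invFun := continuousOn_fst.prodMk
    (continuousOn_snd.add (hf.comp continuousOn_fst fun _ hz => hz.1))

namespace SmoothDistribution

variable {m n : ℕ} {M : Type u} [TopologicalSpace M]
  [ChartedSpace (EuclideanSpace ℝ (Fin (m + n))) M] [IsManifold (𝓡 (m + n)) ∞ M]
  {D : SmoothDistribution m (m + n) M}
  {κ : OpenPartialHomeomorph M (EuclideanSpace ℝ (Fin m) × EuclideanSpace ℝ (Fin n))}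
  {A : EuclideanSpace ℝ (Fin m) × EuclideanSpace ℝ (Fin n) →
    EuclideanSpace ℝ (Fin m) →L[ℝ] EuclideanSpace ℝ (Fin n)}

/-- Graphs of solutions of `Df(x) = A(x, f(x))`, if pairwise disjoint, form an integral manifold. -/
theorem IsGraphIn.isIntegralManifold (h : D.IsGraphIn κ A)
    (hκ : IsSmoothCoordinate (m + n) κ) {J : Type}
    {V : TopologicalSpace.Opens (EuclideanSpace ℝ (Fin m))}
    {f : J → EuclideanSpace ℝ (Fin m) → EuclideanSpace ℝ (Fin n)}
    (hfs : ∀ j, ContDiffOn ℝ ∞ (f j) V)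
    (hf : ∀ j, ∀ x ∈ V, (x, f j x) ∈ κ.target ∧ HasFDerivAt (f j) (A (x, f j x)) x)
    (hdisj : ∀ i j, ∀ x ∈ V, f i x = f j x → i = j) :
    D.IsIntegralManifold m
      (fun p : Plaques.{u} J V => κ.symm (p.proj, f p.idx p.proj)) := by
  set ι := fun p : Plaques.{u} J V => κ.symm (p.proj, f p.idx p.proj) with hι
  have hκι : ∀ p, κ (ι p) = (p.proj, f p.idx p.proj) := fun p =>
    κ.right_inv (hf p.idx p.proj p.proj_mem).1
  have hιs : ∀ p, ι p ∈ κ.source := fun p => κ.map_target (hf p.idx p.proj p.proj_mem).1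
  have hchart : ∀ p : Plaques.{u} J V, IsSmoothCoordinate m p.chart := fun p =>
    .of_mem_maximalAtlas (IsManifold.chart_mem_maximalAtlas p)
  let L : EuclideanSpace ℝ (Fin (m + n)) ≃L[ℝ] EuclideanSpace ℝ (Fin m) × EuclideanSpace ℝ (Fin n) :=
    ContinuousLinearEquiv.ofFinrankEq (by simp)
  have himm : Manifold.IsImmersion (𝓡 m) (𝓡 (m + n)) ∞ ι := by
    refine ⟨EuclideanSpace ℝ (Fin n), inferInstance, inferInstance, fun p => ?_⟩
    -- the coordinates `κ` followed by the shear turn the leaf with index `p.idx` into a flat slice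
    have hsh : IsSmoothCoordinate (m + n)
        (κ.trans (shear V.isOpen (hfs p.idx).continuousOn)) := by
      refine hκ.trans ?_ ?_
      · exact contDiffOn_fst.prodMk
          (contDiffOn_snd.sub ((hfs p.idx).comp contDiffOn_fst fun _ hz => hz.1))
      · exact contDiffOn_fst.prodMk
          (contDiffOn_snd.add ((hfs p.idx).comp contDiffOn_fst fun _ hz => hz.1))
    have hcod := hsh.trans (e := L.symm.toHomeomorph.toOpenPartialHomeomorph)
      L.symm.contDiff.contDiffOn L.contDiff.contDiffOn
    have hsrc : ∀ q : Plaques.{u} J V, ι q ∈ ((κ.trans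
        (shear V.isOpen (hfs p.idx).continuousOn)).trans
          L.symm.toHomeomorph.toOpenPartialHomeomorph).source := by
      intro q
      rw [OpenPartialHomeomorph.trans_source, OpenPartialHomeomorph.trans_source]
      refine ⟨⟨hιs q, ?_, mem_univ _⟩, mem_univ _⟩
      rw [hκι]
      exact q.proj_mem
    refine Manifold.IsImmersionAtOfComplement.mk_of_charts L.symm p.chart _
      (by rw [Plaques.chart_source]; rfl) (hsrc p)
      (IsManifold.chart_mem_maximalAtlas p) hcod.mem_maximalAtlas (fun q _ => hsrc q) ?_
    intro x hx
    have hx : x ∈ V := by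
      simpa [Plaques.chart_target] using hx
    have h1 : κ (ι (p.chart.symm x)) = (x, f p.idx x) := by
      rw [hκι, p.chart_symm_apply hx]; rfl
    simp only [OpenPartialHomeomorph.extend_coe, OpenPartialHomeomorph.extend_coe_symm,
      modelWithCornersSelf_coe, modelWithCornersSelf_coe_symm, Function.comp_id, Function.id_comp,
      Function.comp_apply, OpenPartialHomeomorph.coe_trans, h1]
    change L.symm (x, f p.idx x - f p.idx x) = L.symm (x, 0)
    rw [sub_self]
  refine ⟨himm, fun p q hpq => ?_, fun p => ?_⟩
  · have h1 := congrArg κ hpq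
    rw [hκι, hκι, Prod.mk.injEq] at h1
    refine Plaques.ext (hdisj _ _ p.proj p.proj_mem ?_) h1.1
    rw [h1.2, h1.1]
  · rintro _ ⟨v, rfl⟩
    have hp : p ∈ p.chart.source := by rw [Plaques.chart_source]; rfl
    have hpp : p.chart p = p.proj := p.chart_apply rfl
    have hd := (hf p.idx p.proj p.proj_mem).2
    have h1 := coordDeriv_mfderiv hκ (hchart p)
      (himm.contMDiff.mdifferentiable (by simp) p) hp (hιs p) (g := fun x => (x, f p.idx x))
      (g' := (ContinuousLinearMap.id ℝ _).prod (A (p.proj, f p.idx p.proj)))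
      (by rw [hpp]; exact (hasFDerivAt_id _).prodMk hd) (by
        filter_upwards [p.chart.open_source.mem_nhds hp] with q hq
        rw [Plaques.chart_source] at hq
        rw [hκι, p.chart_apply hq, show q.idx = p.idx from hq]) v
    rw [h.mem_space_iff hκ (hιs p)]
    change (coordDeriv (m + n) κ (ι p) (mfderiv (𝓡 m) (𝓡 (m + n)) ι p v)).2 =
      A (κ (ι p)) (coordDeriv (m + n) κ (ι p) (mfderiv (𝓡 m) (𝓡 (m + n)) ι p v)).1
    rw [h1, hκι]
    rfl

end SmoothDistribution

/-! ### Leaves of involutive distributions -/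

namespace SmoothDistribution

variable {m n k : ℕ} {M : Type u} [TopologicalSpace M]
  [ChartedSpace (EuclideanSpace ℝ (Fin (m + n))) M] [IsManifold (𝓡 (m + n)) ∞ M]
  {D : SmoothDistribution m (m + n) M}

/-- Around every point an involutive distribution is foliated by graphs, all defined over the same
connected open set. -/
theorem IsInvolutive.exists_uniform_graphs [T2Space M] (hD : D.IsInvolutive) (x : M) :
    ∃ (κ : OpenPartialHomeomorph M (EuclideanSpace ℝ (Fin m) × EuclideanSpace ℝ (Fin n)))
      (A : EuclideanSpace ℝ (Fin m) × EuclideanSpace ℝ (Fin n) →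
        EuclideanSpace ℝ (Fin m) →L[ℝ] EuclideanSpace ℝ (Fin n))
      (V : TopologicalSpace.Opens (EuclideanSpace ℝ (Fin m))) (B : Set (EuclideanSpace ℝ (Fin n))),
      IsSmoothCoordinate (m + n) κ ∧ x ∈ κ.source ∧ ContDiffOn ℝ ∞ A κ.target ∧
        D.IsGraphIn κ A ∧ IsPreconnected (V : Set (EuclideanSpace ℝ (Fin m))) ∧ IsOpen B ∧
        κ x ∈ (V : Set (EuclideanSpace ℝ (Fin m))) ×ˢ B ∧
        ∀ z ∈ (V : Set (EuclideanSpace ℝ (Fin m))) ×ˢ B, ∃ f, z.2 = f z.1 ∧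
          ContDiffOn ℝ ∞ f V ∧
          ∀ x ∈ V, (x, f x) ∈ κ.target ∧ HasFDerivAt f (A (x, f x)) x := by
  obtain ⟨κ, A, hκ, hx, hA, h⟩ := D.exists_isGraphIn x
  obtain ⟨r, hr, hr'⟩ := exists_uniform_total_solutions κ.open_target hA
    (fun z hz a b => h.integrability hκ hA hD hz a b) (κ.map_source hx)
  refine ⟨κ, A, ⟨ball (κ x).1 r, isOpen_ball⟩, ball (κ x).2 r, hκ, hx, hA, h,
    (convex_ball _ _).isPreconnected, isOpen_ball,
    ⟨mem_ball_self hr, mem_ball_self hr⟩, fun z hz => ?_⟩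
  obtain ⟨f, h1, h2, h3⟩ := hr' z.1 hz.1 z.2 hz.2
  exact ⟨f, h1.symm, h2, h3⟩

theorem IsInvolutive.hasFullIntegralManifolds [T2Space M] (hD : D.IsInvolutive) :
    D.HasFullIntegralManifolds := by
  intro x
  obtain ⟨κ, A, V, B, hκ, hx, hA, h, hV, hB, hxV, hf⟩ := hD.exists_uniform_graphs x
  obtain ⟨f, hf1, hf2, hf3⟩ := hf _ hxV
  have hN := h.isIntegralManifold hκ (J := Unit) (f := fun _ => f) (fun _ => hf2) (fun _ => hf3)
    (fun _ _ _ _ _ => rfl)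
  refine ⟨Plaques.{u} Unit V, inferInstance, inferInstance, inferInstance, inferInstance, _, hN,
    ⟨Plaques.incl () ⟨_, hxV.1⟩, ?_⟩, hN.range_eq⟩
  change κ.symm ((κ x).1, f (κ x).1) = x
  rw [← hf1, Prod.mk.eta, κ.left_inv hx]

section

variable {N : Type u} [TopologicalSpace N] [ChartedSpace (EuclideanSpace ℝ (Fin k)) N]
  [IsManifold (𝓡 k) ∞ N] {ι : N → M}

/-- An integral manifold, of any dimension, stays locally inside every leaf it meets. -/
theorem IsIntegralManifold.eventually_mem_graph (hι : D.IsIntegralManifold k ι)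
    {κ : OpenPartialHomeomorph M (EuclideanSpace ℝ (Fin m) × EuclideanSpace ℝ (Fin n))}
    {A : EuclideanSpace ℝ (Fin m) × EuclideanSpace ℝ (Fin n) →
      EuclideanSpace ℝ (Fin m) →L[ℝ] EuclideanSpace ℝ (Fin n)}
    (h : D.IsGraphIn κ A) (hκ : IsSmoothCoordinate (m + n) κ) (hA : ContDiffOn ℝ ∞ A κ.target)
    {q : N} (hq : ι q ∈ κ.source) {f : EuclideanSpace ℝ (Fin m) → EuclideanSpace ℝ (Fin n)}
    (hf : ∀ᶠ x in 𝓝 (κ (ι q)).1, HasFDerivAt f (A (x, f x)) x)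
    (h₀ : (κ (ι q)).2 = f (κ (ι q)).1) :
    ∀ᶠ q' in 𝓝 q, (κ (ι q')).2 = f (κ (ι q')).1 := by
  set ψ := chartAt (EuclideanSpace ℝ (Fin k)) q with hψdef
  have hψ : IsSmoothCoordinate k ψ := .of_mem_maximalAtlas (IsManifold.chart_mem_maximalAtlas q)
  have hqψ : q ∈ ψ.source := mem_chart_source _ q
  have hιs := hι.immersion.contMDiff
  set g : EuclideanSpace ℝ (Fin k) → EuclideanSpace ℝ (Fin m) × EuclideanSpace ℝ (Fin n) :=
    fun z => κ (ι (ψ.symm z)) with hg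
  have hgq : g (ψ q) = κ (ι q) := by simp only [hg, ψ.left_inv hqψ]
  set Ω := ψ.target ∩ ψ.symm ⁻¹' (ι ⁻¹' κ.source) with hΩdef
  have hΩ : IsOpen Ω :=
    ψ.symm.isOpen_inter_preimage (κ.open_source.preimage hιs.continuous)
  have hqΩ : ψ q ∈ Ω := ⟨ψ.map_source hqψ, by simpa [ψ.left_inv hqψ] using hq⟩
  have hgs : ContDiffOn ℝ ∞ g Ω := by
    intro z hz
    have h1 : ContMDiffAt 𝓘(ℝ, EuclideanSpace ℝ (Fin k)) 𝓘(ℝ, _) ∞ g z :=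
      (hκ.contMDiffAt hz.2).comp z (hιs.contMDiffAt.comp z (hψ.contMDiffAt_symm hz.1))
    exact h1.contDiffAt.contDiffWithinAt
  have hgd : ∀ z ∈ Ω, HasFDerivAt g (fderiv ℝ g z) z := fun z hz =>
    ((hgs.contDiffAt (hΩ.mem_nhds hz)).differentiableAt (by simp)).hasFDerivAt
  have htan : ∀ z ∈ Ω, ∀ w, (fderiv ℝ g z w).2 = A (g z) (fderiv ℝ g z w).1 := by
    intro z hz w
    have hs : ψ.symm z ∈ ψ.source := ψ.map_target hz.1
    have h1 := coordDeriv_mfderiv hκ hψ (hιs.mdifferentiable (by simp) (ψ.symm z)) hs hz.2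
      (g := g) (g' := fderiv ℝ g z) (by rw [ψ.right_inv hz.1]; exact hgd z hz) (by
        filter_upwards [ψ.open_source.mem_nhds hs] with q' hq'
        simp only [hg, ψ.left_inv hq']) (coordFrame k ψ z w)
    rw [hψ.coordDeriv_coordFrame hz.1] at h1
    have h2 := (h.mem_space_iff hκ hz.2 _).1
      (hι.tangent_le (ψ.symm z) ⟨coordFrame k ψ z w, rfl⟩)
    rw [← h1]
    exact h2
  have key := eventually_snd_eq_of_tangent (A := A) (g := g) (g' := fderiv ℝ g) (z₀ := ψ q) (f := f)
    (by filter_upwards [hΩ.mem_nhds hqΩ] with z hz using hgd z hz)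
    (((hgs.contDiffAt (hΩ.mem_nhds hqΩ)).fderiv_right (m := 0) (by simp)).continuousAt)
    (by filter_upwards [hΩ.mem_nhds hqΩ] with z hz using htan z hz)
    (by rw [hgq]; exact (hA.contDiffAt (κ.open_target.mem_nhds (κ.map_source hq))).of_le (by simp))
    (by rw [hgq]; exact hf) (by rw [hgq]; exact h₀)
  filter_upwards [(ψ.continuousAt hqψ).eventually key, ψ.open_source.mem_nhds hqψ] with q' h1 h2
  simpa only [hg, ψ.left_inv h2] using h1

/-- Near each of its points, an integral manifold of an involutive distribution is contained in a
countable union of pairwise disjoint leaves. Countability comes from the second countability of the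
integral manifold, disjointness from the uniqueness of leaves. -/
theorem IsIntegralManifold.exists_enlargement [T2Space M] [SecondCountableTopology N]
    (hD : D.IsInvolutive) (hι : D.IsIntegralManifold k ι) (p : N) :
    ∃ U : Set M, IsOpen U ∧ ι p ∈ U ∧ ∃ (N' : Type u) (_ : TopologicalSpace N')
      (_ : SecondCountableTopology N') (_ : ChartedSpace (EuclideanSpace ℝ (Fin m)) N')
      (_ : IsManifold (𝓡 m) ∞ N') (ι' : N' → M),
      D.IsIntegralManifold m ι' ∧ range ι ∩ U ⊆ range ι' := by
  obtain ⟨κ, A, V, B, hκ, hx, hA, h, hV, hB, hxV, hf⟩ := hD.exists_uniform_graphs (ι p)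
  have hVB : IsOpen ((V : Set (EuclideanSpace ℝ (Fin m))) ×ˢ B) := V.isOpen.prod hB
  set U := κ.source ∩ κ ⁻¹' ((V : Set (EuclideanSpace ℝ (Fin m))) ×ˢ B) with hUdef
  have hU : IsOpen U := κ.isOpen_inter_preimage hVB
  choose! f hf1 hf2 hf3 using hf
  -- `W q` is the set of points of `N` on the leaf through `q`, a neighbourhood of `q`
  set W : N → Set N := fun q => {q' | (κ (ι q')).2 = f (κ (ι q)) (κ (ι q')).1} with hW
  have hWq : ∀ q ∈ ι ⁻¹' U, W q ∈ 𝓝[ι ⁻¹' U] q := by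
    intro q hq
    refine mem_nhdsWithin_of_mem_nhds (hι.eventually_mem_graph h hκ hA hq.1 ?_ (hf1 _ hq.2))
    filter_upwards [V.isOpen.mem_nhds hq.2.1] with x hxV using (hf3 _ hq.2 x hxV).2
  obtain ⟨T, hTU, hT, hcov⟩ := TopologicalSpace.countable_cover_nhdsWithin hWq
  -- leaves are indexed by the functions on `V` of which they are the graphs, extended by zero so
  -- that equal leaves have equal indices
  set R : Set (EuclideanSpace ℝ (Fin m) → EuclideanSpace ℝ (Fin n)) :=
    (fun q => (V : Set (EuclideanSpace ℝ (Fin m))).indicator (f (κ (ι q)))) '' T with hR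
  have hRc : Countable R := (hT.image _).to_subtype
  have hRs : ∀ j : R, ∃ q ∈ T, EqOn j.1 (f (κ (ι q))) V := by
    rintro ⟨_, q, hq, rfl⟩
    exact ⟨q, hq, fun x hx => indicator_of_mem hx _⟩
  choose s hsT hs using hRs
  have hzero : ∀ j : R, ∀ x ∉ V, j.1 x = 0 := by
    rintro ⟨_, q, hq, rfl⟩ x hx
    exact indicator_of_notMem hx _
  have hsol : ∀ j : R, ∀ x ∈ V, (x, j.1 x) ∈ κ.target ∧ HasFDerivAt j.1 (A (x, j.1 x)) x := by
    intro j x hx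
    have h1 := hf3 _ (hTU (hsT j)).2 x hx
    rw [hs j hx]
    refine ⟨h1.1, h1.2.congr_of_eventuallyEq ?_⟩
    filter_upwards [V.isOpen.mem_nhds hx] with y hy using hs j hy
  refine ⟨U, hU, ⟨hx, hxV⟩, Plaques.{u} R V, inferInstance, inferInstance, inferInstance,
    inferInstance, _, h.isIntegralManifold hκ (f := fun j : R => j.1)
      (fun j => (hf2 _ (hTU (hsT j)).2).congr (hs j)) hsol ?_, ?_⟩
  · intro i j x hx hij
    have h1 := total_solution_unique κ.open_target (hA.of_le (by simp)) V.isOpen hV (hsol i)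
      (hsol j) hx hij
    refine Subtype.ext (funext fun y => ?_)
    by_cases hy : y ∈ V
    · exact h1 hy
    · rw [hzero i y hy, hzero j y hy]
  · rintro _ ⟨⟨q', rfl⟩, hq'⟩
    obtain ⟨q, hq, hqW⟩ := mem_iUnion₂.1 (hcov hq')
    refine ⟨Plaques.incl ⟨_, q, hq, rfl⟩ ⟨(κ (ι q')).1, hq'.2.1⟩, ?_⟩
    change κ.symm ((κ (ι q')).1, (V : Set (EuclideanSpace ℝ (Fin m))).indicator (f (κ (ι q)))
      (κ (ι q')).1) = ι q'
    have h2 : (κ (ι q')).2 = f (κ (ι q)) (κ (ι q')).1 := hqW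
    rw [indicator_of_mem (show (κ (ι q')).1 ∈ (V : Set _) from hq'.2.1), ← h2, Prod.mk.eta,
      κ.left_inv hq'.1]

end

/-- By `IsIntegralManifold.exists_enlargement`, an integral manifold of less than full dimension is
not maximal. -/
theorem IsInvolutive.isCompletelyIntegrable [T2Space M] (hD : D.IsInvolutive) :
    D.IsCompletelyIntegrable := by
  intro k N _ _ _ _ ι hN p
  obtain rfl | hk := (hN.1.le p).eq_or_lt
  · exact hN.1.range_eq p
  · obtain ⟨U, hU, hpU, N', _, _, _, _, ι', hι', hsub⟩ := hN.1.exists_enlargement hD p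
    exact absurd hsub (hN.2 p U hU hpU m N' ι' hk hι')

end SmoothDistribution

/-! ### The variational equation of a flow -/

section Variation

/-- Vanishing of a curve that satisfies a linear differential inequality is a locally constant
condition. -/
theorem eventually_eq_zero_iff_of_norm_deriv_le {E : Type*} [NormedAddCommGroup E]
    [NormedSpace ℝ E] {f f' : ℝ → E} {c : ℝ → ℝ} {t₀ : ℝ}
    (hf : ∀ᶠ t in 𝓝 t₀, HasDerivAt f (f' t) t) (hc : ContinuousAt c t₀)
    (h : ∀ᶠ t in 𝓝 t₀, ‖f' t‖ ≤ c t * ‖f t‖) : ∀ᶠ t in 𝓝 t₀, f t₀ = 0 ↔ f t = 0 := by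
  have hK : ∀ᶠ t in 𝓝 t₀, c t < c t₀ + 1 := hc.eventually (gt_mem_nhds (lt_add_one _))
  obtain ⟨ε, hε, hball⟩ := Metric.eventually_nhds_iff_ball.1 (hf.and (h.and hK))
  rw [Real.ball_eq_Ioo] at hball
  have h1 : ∀ t ∈ Ioo (t₀ - ε) (t₀ + ε), ‖f' t‖ ≤ (c t₀ + 1) * ‖f t‖ := fun t ht =>
    (hball t ht).2.1.trans (mul_le_mul_of_nonneg_right (hball t ht).2.2.le (norm_nonneg _))
  have h0 : t₀ ∈ Ioo (t₀ - ε) (t₀ + ε) := ⟨by linarith, by linarith⟩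
  filter_upwards [Ioo_mem_nhds h0.1 h0.2] with t ht
  exact ⟨eq_zero_of_norm_deriv_le (fun t ht => (hball t ht).1) h1 h0 ht,
    eq_zero_of_norm_deriv_le (fun t ht => (hball t ht).1) h1 ht h0⟩

/-- The spatial derivative of a flow satisfies the linearized equation, by symmetry of the second
derivative. -/
theorem hasDerivAt_fderiv_of_flow {G V : Type*} [NormedAddCommGroup G] [NormedSpace ℝ G]
    [NormedAddCommGroup V] [NormedSpace ℝ V] {Φ : ℝ × G → V} {Y : V → V} {q : ℝ × G}
    (hΦ : ContDiffAt ℝ ∞ Φ q) (hY : DifferentiableAt ℝ Y (Φ q))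
    (h : ∀ᶠ q' in 𝓝 q, fderiv ℝ Φ q' (1, 0) = Y (Φ q')) (w : G) :
    HasDerivAt (fun t => fderiv ℝ Φ (t, q.2) (0, w)) (fderiv ℝ Y (Φ q) (fderiv ℝ Φ q (0, w)))
      q.1 := by
  have h1 : HasFDerivAt (fderiv ℝ Φ) (fderiv ℝ (fderiv ℝ Φ) q) q :=
    ((hΦ.fderiv_right (m := 1) (by decide)).differentiableAt (by simp)).hasFDerivAt
  have h2 : HasFDerivAt Φ (fderiv ℝ Φ q) q := (hΦ.differentiableAt (by simp)).hasFDerivAt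
  have hsymm : fderiv ℝ (fderiv ℝ Φ) q (1, 0) (0, w) = fderiv ℝ (fderiv ℝ Φ) q (0, w) (1, 0) :=
    (hΦ.isSymmSndFDerivAt (by rw [minSmoothness_of_isRCLikeNormedField]; decide)) _ _
  have h3 : HasFDerivAt (fun q' => fderiv ℝ Φ q' (1, 0)) _ q :=
    h1.clm_apply (hasFDerivAt_const ((1 : ℝ), (0 : G)) q)
  have h4 := h3.unique ((hY.hasFDerivAt.comp q h2).congr_of_eventuallyEq h)
  have h5 : fderiv ℝ (fderiv ℝ Φ) q (0, w) (1, 0) = fderiv ℝ Y (Φ q) (fderiv ℝ Φ q (0, w)) := by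
    have := congr($h4 (0, w))
    simpa using this
  have h6 : HasDerivAt (fun t : ℝ => (t, q.2)) ((1 : ℝ), (0 : G)) q.1 :=
    (hasDerivAt_id q.1).prodMk (hasDerivAt_const q.1 q.2)
  have h7 : HasFDerivAt (fun q' => fderiv ℝ Φ q' (0, w)) _ q :=
    h1.clm_apply (hasFDerivAt_const ((0 : ℝ), w) q)
  have h8 := h7.comp_hasDerivAt q.1 h6
  rw [← h5, ← hsymm]
  simpa [Function.comp_def] using h8

variable {E F : Type*} [NormedAddCommGroup E] [NormedSpace ℝ E] [NormedAddCommGroup F]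
  [NormedSpace ℝ F]

/-- Let `Y` be tangent to the involutive field of graphs of `A`. For a solution `W` of the
linearization of `Y` along an integral curve `c`, the defect `W.2 - A c W.1`, which measures how
far `W` is from being tangent to the field of graphs, satisfies a homogeneous linear equation. -/
theorem hasDerivAt_defect {A : E × F → E →L[ℝ] F} {Y : E × F → E × F} {c W : ℝ → E × F} {t : ℝ}
    (hA : DifferentiableAt ℝ A (c t)) (hY : DifferentiableAt ℝ Y (c t))
    (htan : ∀ᶠ z in 𝓝 (c t), (Y z).2 = A z (Y z).1)
    (h_int : ∀ a b : E, fderiv ℝ A (c t) (a, A (c t) a) b = fderiv ℝ A (c t) (b, A (c t) b) a)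
    (hc : HasDerivAt c (Y (c t)) t) (hW : HasDerivAt W (fderiv ℝ Y (c t) (W t)) t) :
    HasDerivAt (fun s => (W s).2 - A (c s) (W s).1)
      (fderiv ℝ A (c t) (0, (W t).2 - A (c t) (W t).1) (Y (c t)).1) t := by
  have hW1 := (ContinuousLinearMap.fst ℝ E F).hasFDerivAt.comp_hasDerivAt t hW
  have hW2 := (ContinuousLinearMap.snd ℝ E F).hasFDerivAt.comp_hasDerivAt t hW
  have hAc := hA.hasFDerivAt.comp_hasDerivAt t hc
  have h1 := hW2.sub (hAc.clm_apply hW1)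
  refine h1.congr_deriv ?_
  -- differentiate the tangency of `Y` in the direction `W t`
  have hY1 := (ContinuousLinearMap.fst ℝ E F).hasFDerivAt.comp (c t) hY.hasFDerivAt
  have hY2 := (ContinuousLinearMap.snd ℝ E F).hasFDerivAt.comp (c t) hY.hasFDerivAt
  have h2 := (hY2.congr_of_eventuallyEq (f := fun z => (Y z).2) (by rfl)).unique
    ((hA.hasFDerivAt.clm_apply hY1).congr_of_eventuallyEq htan)
  have h3 : (fderiv ℝ Y (c t) (W t)).2 = A (c t) (fderiv ℝ Y (c t) (W t)).1 +
      fderiv ℝ A (c t) (W t) (Y (c t)).1 := by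
    have := congr($h2 (W t))
    simpa using this
  -- integrability, applied to `Y (c t) = (b, A b)` with `b` its first component
  have h4 : fderiv ℝ A (c t) (Y (c t)) (W t).1 =
      fderiv ℝ A (c t) ((W t).1, A (c t) (W t).1) (Y (c t)).1 := by
    rw [h_int, ← htan.self_of_nhds]
  have h5 : W t = ((W t).1, A (c t) (W t).1) + (0, (W t).2 - A (c t) (W t).1) := by simp
  have h6 : fderiv ℝ A (c t) (W t) (Y (c t)).1 =
      fderiv ℝ A (c t) ((W t).1, A (c t) (W t).1) (Y (c t)).1 +
        fderiv ℝ A (c t) (0, (W t).2 - A (c t) (W t).1) (Y (c t)).1 := by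
    conv_lhs => rw [h5]
    rw [map_add, add_apply]
  simp only [ContinuousLinearMap.coe_fst', ContinuousLinearMap.coe_snd', Function.comp_apply]
  rw [h3, h6, h4]
  abel

end Variation

/-! ### Flows of sections preserve an involutive distribution -/

namespace IsFlowOn

variable {d : ℕ} {M : Type u} [TopologicalSpace M]
    [ChartedSpace (EuclideanSpace ℝ (Fin d)) M] [IsManifold (𝓡 d) ∞ M]
    {X : ∀ x : M, TangentSpace (𝓡 d) x} {J : Set ℝ} {U : Set M} {φ : ℝ → M → M}

theorem contMDiffAt (h : IsFlowOn X J U φ) {t : ℝ} (ht : t ∈ J) {x : M} (hx : x ∈ U) :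
    ContMDiffAt (𝓘(ℝ, ℝ).prod (𝓡 d)) (𝓡 d) ∞ (fun q : ℝ × M => φ q.1 q.2) (t, x) :=
  h.smooth.contMDiffAt ((h.isOpen_time.prod h.isOpen_space).mem_nhds ⟨ht, hx⟩)

theorem contMDiffAt_apply (h : IsFlowOn X J U φ) {t : ℝ} (ht : t ∈ J) {x : M} (hx : x ∈ U) :
    ContMDiffAt (𝓡 d) (𝓡 d) ∞ (φ t) x :=
  (h.contMDiffAt ht hx).comp x (contMDiffAt_const.prodMk contMDiffAt_id)

/-- At time zero the derivative of the flow is the identity. All tangent spaces are identified with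
the model space, since `φ 0 x` and `x` agree only propositionally. -/
theorem mfderiv_zero (h : IsFlowOn X J U φ) {x : M} (hx : x ∈ U)
    (v : TangentSpace (𝓡 d) x) : (mfderiv (𝓡 d) (𝓡 d) (φ 0) x v : EuclideanSpace ℝ (Fin d)) = v := by
  have h1 : φ 0 =ᶠ[𝓝 x] id := by
    filter_upwards [h.isOpen_space.mem_nhds hx] with y hy using h.map_zero y hy
  have h2 := h1.mfderiv_eq (I := 𝓡 d) (I' := 𝓡 d)
  rw [mfderiv_id] at h2
  exact congr($h2 v)

variable {V : Type*} [NormedAddCommGroup V] [NormedSpace ℝ V]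

/-- In coordinates `κ` on the target, the velocity of the flow is the coordinate expression of the
vector field. -/
theorem hasDerivAt_coord (h : IsFlowOn X J U φ) {κ : OpenPartialHomeomorph M V}
    (hκ : IsSmoothCoordinate d κ) {t : ℝ} (ht : t ∈ J) {x : M} (hx : x ∈ U)
    (hxκ : φ t x ∈ κ.source) :
    HasDerivAt (fun s => κ (φ s x)) (fieldRep κ X (κ (φ t x))) t := by
  have h1 := (h.integralCurve x hx t ht).hasMFDerivAt (h.isOpen_time.mem_nhds ht)
  have h2 := ((hκ.contMDiffAt hxκ).mdifferentiableAt (by simp)).hasMFDerivAt.comp t h1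
  have h3 : HasFDerivAt (fun s => κ (φ s x)) ((coordDeriv d κ (φ t x)).comp
      ((1 : ℝ →L[ℝ] ℝ).smulRight (X (φ t x))) : ℝ →L[ℝ] V) t := h2.hasFDerivAt
  have h4 := hκ.fieldRep_eq_coordDeriv (κ.map_source hxκ) X
  rw [κ.left_inv hxκ] at h4
  rw [h4]
  refine h3.hasDerivAt.congr_deriv ?_
  have h5 : ((1 : ℝ →L[ℝ] ℝ).smulRight (X (φ t x))) (1 : ℝ) = X (φ t x) := by
    simp
  exact congrArg (coordDeriv d κ (φ t x)) h5

/-- Coordinate expression of the derivative of the flow near time `t₀`: a solution `W` of the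
linearization of `X` along the integral curve through `x`. -/
theorem exists_variation [CompleteSpace V] (h : IsFlowOn X J U φ) (hX : SmoothVectorFieldOn X univ)
    {κ : OpenPartialHomeomorph M V} (hκ : IsSmoothCoordinate d κ) {t₀ : ℝ} (ht₀ : t₀ ∈ J) {x : M}
    (hx : x ∈ U) (hxκ : φ t₀ x ∈ κ.source) (v : TangentSpace (𝓡 d) x) :
    ∃ W : ℝ → V, ∀ᶠ t in 𝓝 t₀, t ∈ J ∧ φ t x ∈ κ.source ∧
      coordDeriv d κ (φ t x) (mfderiv (𝓡 d) (𝓡 d) (φ t) x v) = W t ∧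
      HasDerivAt W (fderiv ℝ (fieldRep κ X) (κ (φ t x)) (W t)) t := by
  set ψ := chartAt (EuclideanSpace ℝ (Fin d)) x with hψdef
  have hψ : IsSmoothCoordinate d ψ := .of_mem_maximalAtlas (IsManifold.chart_mem_maximalAtlas x)
  have hxψ : x ∈ ψ.source := mem_chart_source _ x
  set Φ : ℝ × EuclideanSpace ℝ (Fin d) → V := fun q => κ (φ q.1 (ψ.symm q.2)) with hΦdef
  set w : EuclideanSpace ℝ (Fin d) := coordDeriv d ψ x v with hw
  have hXs : ContDiffOn ℝ ∞ (fieldRep κ X) κ.target := by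
    have := hκ.contDiffOn_fieldRep isOpen_univ hX
    rwa [preimage_univ, inter_univ] at this
  have hgood : ∀ᶠ q in 𝓝 (t₀, ψ x), q.1 ∈ J ∧ q.2 ∈ ψ.target ∧ ψ.symm q.2 ∈ U ∧
      φ q.1 (ψ.symm q.2) ∈ κ.source := by
    have hc1 : ContinuousAt (fun q : ℝ × EuclideanSpace ℝ (Fin d) => ψ.symm q.2) (t₀, ψ x) :=
      ContinuousAt.comp' (ψ.continuousAt_symm (ψ.map_source hxψ)) continuousAt_snd
    have hc2 : ContinuousAt (fun q : ℝ × EuclideanSpace ℝ (Fin d) => φ q.1 (ψ.symm q.2))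
        (t₀, ψ x) := by
      refine ContinuousAt.comp' (f := fun q : ℝ × EuclideanSpace ℝ (Fin d) => (q.1, ψ.symm q.2))
        (g := fun q : ℝ × M => φ q.1 q.2) ?_ (continuousAt_fst.prodMk hc1)
      rw [ψ.left_inv hxψ]
      exact (h.contMDiffAt ht₀ hx).continuousAt
    refine (continuousAt_fst.eventually (h.isOpen_time.mem_nhds ht₀)).and
      ((continuousAt_snd.eventually (ψ.open_target.mem_nhds (ψ.map_source hxψ))).and
        ((hc1.eventually (h.isOpen_space.mem_nhds ?_)).and
          (hc2.eventually (κ.open_source.mem_nhds ?_))))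
    all_goals simpa only [ψ.left_inv hxψ]
  have hΦs : ∀ q : ℝ × EuclideanSpace ℝ (Fin d), q.1 ∈ J ∧ q.2 ∈ ψ.target ∧ ψ.symm q.2 ∈ U ∧
      φ q.1 (ψ.symm q.2) ∈ κ.source → ContDiffAt ℝ ∞ Φ q := by
    rintro q ⟨h1, h2, h3, h4⟩
    have h5 : ContMDiffAt 𝓘(ℝ, ℝ × EuclideanSpace ℝ (Fin d)) (𝓘(ℝ, ℝ).prod (𝓡 d)) ∞
        (fun q : ℝ × EuclideanSpace ℝ (Fin d) => (q.1, ψ.symm q.2)) q :=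
      contDiffAt_fst.contMDiffAt.prodMk
        ((hψ.contMDiffAt_symm h2).comp q contDiffAt_snd.contMDiffAt)
    have h6 : ContMDiffAt 𝓘(ℝ, ℝ × EuclideanSpace ℝ (Fin d)) 𝓘(ℝ, V) ∞ Φ q :=
      (hκ.contMDiffAt h4).comp q ((h.contMDiffAt h1 h3).comp q h5)
    exact h6.contDiffAt
  have hΦt : ∀ q : ℝ × EuclideanSpace ℝ (Fin d), q.1 ∈ J ∧ q.2 ∈ ψ.target ∧ ψ.symm q.2 ∈ U ∧
      φ q.1 (ψ.symm q.2) ∈ κ.source → fderiv ℝ Φ q (1, 0) = fieldRep κ X (Φ q) := by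
    intro q hq
    have h1 := ((hΦs q hq).differentiableAt (by simp)).hasFDerivAt.comp_hasDerivAt q.1
      ((hasDerivAt_id q.1).prodMk (hasDerivAt_const q.1 q.2))
    exact h1.unique (h.hasDerivAt_coord hκ hq.1 hq.2.2.1 hq.2.2.2)
  refine ⟨fun t => fderiv ℝ Φ (t, ψ x) (0, w), ?_⟩
  have hc3 : ContinuousAt (fun t : ℝ => (t, ψ x)) t₀ := continuousAt_id.prodMk continuousAt_const
  filter_upwards [hc3.eventually hgood.eventually_nhds] with t ht
  have ht' := ht.self_of_nhds
  have hφt : φ t x ∈ κ.source := by simpa only [ψ.left_inv hxψ] using ht'.2.2.2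
  have hΦx : Φ (t, ψ x) = κ (φ t x) := by simp only [hΦdef, ψ.left_inv hxψ]
  refine ⟨ht'.1, hφt, ?_, ?_⟩
  · have h1 := ((hΦs _ ht').differentiableAt (by simp)).hasFDerivAt.comp (ψ x)
      ((hasFDerivAt_const t (ψ x)).prodMk (hasFDerivAt_id (ψ x)))
    refine (coordDeriv_mfderiv hκ hψ ((h.contMDiffAt_apply ht'.1 hx).mdifferentiableAt (by simp))
      hxψ hφt h1 ?_ v).trans (by simp [hw])
    filter_upwards [ψ.open_source.mem_nhds hxψ] with y hy
    simp only [Function.comp_apply, hΦdef, ψ.left_inv hy]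
  · have h1 := hasDerivAt_fderiv_of_flow (Y := fieldRep κ X) (hΦs _ ht') (by
      rw [hΦx]
      exact (hXs.contDiffAt (κ.open_target.mem_nhds (κ.map_source hφt))).differentiableAt (by simp))
      (ht.mono hΦt) w
    rwa [hΦx] at h1

end IsFlowOn

namespace SmoothDistribution

variable {m n : ℕ} {M : Type u} [TopologicalSpace M] [T2Space M]
  [ChartedSpace (EuclideanSpace ℝ (Fin (m + n))) M] [IsManifold (𝓡 (m + n)) ∞ M]
  {D : SmoothDistribution m (m + n) M} {X : ∀ x : M, TangentSpace (𝓡 (m + n)) x} {J : Set ℝ}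
  {U : Set M} {φ : ℝ → M → M}

/-- Whether the vector `v`, transported by the flow, lies in `D`, or vanishes, is locally constant in
time: in graph coordinates both conditions are the vanishing of a solution of a homogeneous linear
equation. -/
theorem IsInvolutive.eventually_mfderiv_flow (hD : D.IsInvolutive) (hX : D.IsSection X)
    (h : IsFlowOn X J U φ) {t₀ : ℝ} (ht₀ : t₀ ∈ J) {x : M} (hx : x ∈ U)
    (v : TangentSpace (𝓡 (m + n)) x) : ∀ᶠ t in 𝓝 t₀,
      (mfderiv (𝓡 (m + n)) (𝓡 (m + n)) (φ t₀) x v ∈ D.space (φ t₀ x) ↔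
        mfderiv (𝓡 (m + n)) (𝓡 (m + n)) (φ t) x v ∈ D.space (φ t x)) ∧
      (mfderiv (𝓡 (m + n)) (𝓡 (m + n)) (φ t₀) x v = 0 ↔
        mfderiv (𝓡 (m + n)) (𝓡 (m + n)) (φ t) x v = 0) := by
  obtain ⟨κ, A, hκ, hxκ, hA, hg⟩ := D.exists_isGraphIn (φ t₀ x)
  obtain ⟨W, hW⟩ := h.exists_variation hX.1 hκ ht₀ hx hxκ v
  set Y := fieldRep κ X with hYdef
  set c : ℝ → EuclideanSpace ℝ (Fin m) × EuclideanSpace ℝ (Fin n) := fun t => κ (φ t x) with hcdef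
  have hYs : ContDiffOn ℝ ∞ Y κ.target := by
    have := hκ.contDiffOn_fieldRep isOpen_univ hX.1
    rwa [preimage_univ, inter_univ] at this
  have hYt : ∀ z ∈ κ.target, ContDiffAt ℝ ∞ Y z := fun z hz =>
    hYs.contDiffAt (κ.open_target.mem_nhds hz)
  have hAt : ∀ z ∈ κ.target, ContDiffAt ℝ ∞ A z := fun z hz =>
    hA.contDiffAt (κ.open_target.mem_nhds hz)
  have hc₀ : c t₀ ∈ κ.target := κ.map_source hxκ
  have hc : ∀ᶠ t in 𝓝 t₀, HasDerivAt c (Y (c t)) t ∧ c t ∈ κ.target :=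
    hW.mono fun t ht => ⟨h.hasDerivAt_coord hκ ht.1 hx ht.2.1, κ.map_source ht.2.1⟩
  have hcc : ContinuousAt c t₀ := hc.self_of_nhds.1.continuousAt
  have hdY : ContinuousAt (fun t => ‖fderiv ℝ Y (c t)‖) t₀ :=
    (ContinuousAt.comp' ((hYt _ hc₀).fderiv_right (m := 0) (by simp)).continuousAt hcc).norm
  have hdA : ContinuousAt (fun t => ‖fderiv ℝ A (c t)‖ * ‖(Y (c t)).1‖) t₀ :=
    (ContinuousAt.comp' ((hAt _ hc₀).fderiv_right (m := 0) (by simp)).continuousAt hcc).norm.mul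
      (ContinuousAt.comp' (hYt _ hc₀).continuousAt hcc).fst.norm
  have h1 := eventually_eq_zero_iff_of_norm_deriv_le (f := W)
    (f' := fun t => fderiv ℝ Y (c t) (W t)) (hW.mono fun t ht => ht.2.2.2) hdY
    (.of_forall fun t => (fderiv ℝ Y (c t)).le_opNorm _)
  have h2 := eventually_eq_zero_iff_of_norm_deriv_le (f := fun t => (W t).2 - A (c t) (W t).1)
    (f' := fun t => fderiv ℝ A (c t) (0, (W t).2 - A (c t) (W t).1) (Y (c t)).1)
    (by
      filter_upwards [hW, hc] with t ht hct
      exact hasDerivAt_defect ((hAt _ hct.2).differentiableAt (by simp))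
        ((hYt _ hct.2).differentiableAt (by simp))
        (by filter_upwards [κ.open_target.mem_nhds hct.2] with z hz using hg.fieldRep_snd hκ hX hz)
        (hg.integrability hκ hA hD hct.2) hct.1 ht.2.2.2) hdA
    (.of_forall fun t => by
      refine ((fderiv ℝ A (c t) _).le_opNorm _).trans ?_
      rw [mul_right_comm]
      refine mul_le_mul_of_nonneg_right (((fderiv ℝ A (c t)).le_opNorm _).trans_eq ?_)
        (norm_nonneg _)
      rw [Prod.norm_mk, norm_zero, max_eq_right (norm_nonneg _)])
  have hzero : ∀ t, t ∈ J ∧ φ t x ∈ κ.source ∧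
      coordDeriv (m + n) κ (φ t x) (mfderiv (𝓡 (m + n)) (𝓡 (m + n)) (φ t) x v) = W t ∧
      HasDerivAt W (fderiv ℝ Y (c t) (W t)) t →
      (mfderiv (𝓡 (m + n)) (𝓡 (m + n)) (φ t) x v = 0 ↔ W t = 0) ∧
      (mfderiv (𝓡 (m + n)) (𝓡 (m + n)) (φ t) x v ∈ D.space (φ t x) ↔
        (W t).2 - A (c t) (W t).1 = 0) := by
    rintro t ⟨-, ht, htW, -⟩
    rw [hg.mem_space_iff hκ ht, htW, sub_eq_zero]
    refine ⟨⟨fun h => ?_, fun h => hκ.mdifferentiable.mfderiv_injective ht ?_⟩, Iff.rfl⟩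
    · rw [← htW, h, map_zero]
    · exact (htW.trans h).trans (map_zero (coordDeriv (m + n) κ (φ t x))).symm
  have h₀ := hzero t₀ hW.self_of_nhds
  filter_upwards [hW, h1, h2] with t ht h1 h2
  have h₁ := hzero t ht
  exact ⟨h₀.2.trans (h2.trans h₁.2.symm), h₀.1.trans (h1.trans h₁.1.symm)⟩

theorem IsInvolutive.isInfinitesimalSymmetry (hD : D.IsInvolutive) (hX : D.IsSection X) :
    D.IsInfinitesimalSymmetry X := by
  intro J U φ h t ht x hx
  have key : ∀ v : TangentSpace (𝓡 (m + n)) x,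
      (v ∈ D.space x ↔ mfderiv (𝓡 (m + n)) (𝓡 (m + n)) (φ t) x v ∈ D.space (φ t x)) ∧
      (v = 0 ↔ mfderiv (𝓡 (m + n)) (𝓡 (m + n)) (φ t) x v = 0) := by
    intro v
    have h1 := h.ordConnected_time.isPreconnected.induction₂ (fun s t =>
      (mfderiv (𝓡 (m + n)) (𝓡 (m + n)) (φ s) x v ∈ D.space (φ s x) ↔
        mfderiv (𝓡 (m + n)) (𝓡 (m + n)) (φ t) x v ∈ D.space (φ t x)) ∧
      (mfderiv (𝓡 (m + n)) (𝓡 (m + n)) (φ s) x v = 0 ↔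
        mfderiv (𝓡 (m + n)) (𝓡 (m + n)) (φ t) x v = 0))
      (fun s hs => mem_nhdsWithin_of_mem_nhds (hD.eventually_mfderiv_flow hX h hs hx v))
      (fun _ _ _ _ _ _ h h' => ⟨h.1.trans h'.1, h.2.trans h'.2⟩)
      (fun _ _ _ _ h => ⟨h.1.symm, h.2.symm⟩) h.zero_mem_time ht
    have h2 := h.mfderiv_zero hx v
    have h3 : ∀ y, y = x → ∀ w : EuclideanSpace ℝ (Fin (m + n)), w = v →
        (v ∈ D.space x ↔ (show TangentSpace (𝓡 (m + n)) y from w) ∈ D.space y) := by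
      rintro _ rfl _ rfl
      rfl
    exact ⟨(h3 _ (h.map_zero x hx) _ h2).trans h1.1,
      (show v = 0 ↔ (mfderiv (𝓡 (m + n)) (𝓡 (m + n)) (φ 0) x v : EuclideanSpace ℝ (Fin (m + n))) = 0
        by rw [h2]; rfl).trans h1.2⟩
  have hinj : Function.Injective (mfderiv (𝓡 (m + n)) (𝓡 (m + n)) (φ t) x).toLinearMap :=
    (injective_iff_map_eq_zero _).2 fun v hv => (key v).2.2 hv
  refine Submodule.eq_of_le_of_finrank_eq ?_ ?_
  · rintro _ ⟨v, hv, rfl⟩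
    exact (key v).1.1 hv
  · rw [D.finrank_space]
    exact (Submodule.equivMapOfInjective _ hinj _).finrank_eq.symm.trans (D.finrank_space x)

end SmoothDistribution

/-! ### Restrictions of integral manifolds, and points as integral manifolds -/

section Immersion

variable {d k : ℕ} {M : Type u} [TopologicalSpace M]
  [ChartedSpace (EuclideanSpace ℝ (Fin d)) M] [IsManifold (𝓡 d) ∞ M]
  {N : Type u} [TopologicalSpace N] [ChartedSpace (EuclideanSpace ℝ (Fin k)) N]
  [IsManifold (𝓡 k) ∞ N]

theorem IsSmoothCoordinate.subtypeRestr {V : Type*} [NormedAddCommGroup V] [NormedSpace ℝ V]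
    {κ : OpenPartialHomeomorph N V} (hκ : IsSmoothCoordinate k κ)
    {s : TopologicalSpace.Opens N} (hs : Nonempty s) :
    IsSmoothCoordinate k (κ.subtypeRestr hs) where
  contMDiffOn := by
    rw [κ.subtypeRestr_source, κ.subtypeRestr_coe]
    exact hκ.contMDiffOn.comp contMDiff_subtype_val.contMDiffOn fun _ hx => hx
  contMDiffOn_symm := by
    intro z hz
    have h1 : Subtype.val ∘ (κ.subtypeRestr hs).symm =ᶠ[𝓝 z] κ.symm := by
      filter_upwards [(κ.subtypeRestr hs).open_target.mem_nhds hz] with y hy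
      exact κ.subtypeRestr_symm_apply hs hy
    have h2 := Manifold.IsImmersionAt.of_opens (I := 𝓡 k) (n := ∞) s
      ((κ.subtypeRestr hs).symm z).2
    exact ((ContMDiffAt.iff_comp_isImmersionAt h2).2
      ⟨(κ.subtypeRestr hs).continuousAt_symm hz,
        (hκ.contMDiffAt_symm (κ.subtypeRestr_target_subset hs hz)).congr_of_eventuallyEq
          h1⟩).contMDiffWithinAt

omit [IsManifold (𝓡 d) ∞ M] in
theorem Manifold.IsImmersion.comp_subtype_val {ι : N → M}
    (h : Manifold.IsImmersion (𝓡 k) (𝓡 d) ∞ ι) (s : TopologicalSpace.Opens N) :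
    Manifold.IsImmersion (𝓡 k) (𝓡 d) ∞ (fun p : s => ι p) := by
  obtain ⟨F, _, _, hF⟩ := h
  refine ⟨F, inferInstance, inferInstance, fun p => ?_⟩
  have hp := hF p
  have hs : Nonempty s := ⟨p⟩
  have hdom := (IsSmoothCoordinate.of_mem_maximalAtlas
    hp.domChart_mem_maximalAtlas).subtypeRestr hs
  refine Manifold.IsImmersionAtOfComplement.mk_of_charts hp.equiv
    (hp.domChart.subtypeRestr hs) hp.codChart
    (by rw [OpenPartialHomeomorph.subtypeRestr_source]; exact hp.mem_domChart_source)
    hp.mem_codChart_source hdom.mem_maximalAtlas hp.codChart_mem_maximalAtlas ?_ ?_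
  · rw [OpenPartialHomeomorph.subtypeRestr_source]
    exact fun q hq => hp.source_subset_preimage_source hq
  · intro z hz
    have hz : z ∈ (hp.domChart.subtypeRestr hs).target := by simpa using hz
    have h1 : ((hp.domChart.subtypeRestr hs).symm z : N) = hp.domChart.symm z :=
      hp.domChart.subtypeRestr_symm_apply hs hz
    have hz' : z ∈ (hp.domChart.extend (𝓡 k)).target := by
      simpa using hp.domChart.subtypeRestr_target_subset hs hz
    have h2 := hp.writtenInCharts hz'
    simp only [OpenPartialHomeomorph.extend_coe, OpenPartialHomeomorph.extend_coe_symm,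
      modelWithCornersSelf_coe, modelWithCornersSelf_coe_symm, Function.comp_apply, id] at h2 ⊢
    rw [h1]
    exact h2

/-- Every map from a `0`-dimensional manifold onto a point is an immersion. -/
theorem Manifold.isImmersion_const {P : Type u} [TopologicalSpace P]
    [ChartedSpace (EuclideanSpace ℝ (Fin 0)) P] [IsManifold (𝓡 0) ∞ P] (x : M) :
    Manifold.IsImmersion (𝓡 0) (𝓡 d) ∞ (fun _ : P => x) := by
  refine ⟨EuclideanSpace ℝ (Fin d), inferInstance, inferInstance, fun p => ?_⟩
  set e := chartAt (EuclideanSpace ℝ (Fin d)) x with he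
  -- the chart at `x`, translated so that `x` has coordinate `0`
  have hcod := (IsSmoothCoordinate.of_mem_maximalAtlas (IsManifold.chart_mem_maximalAtlas
    (I := 𝓡 d) (n := ∞) x)).trans
    (e := (Homeomorph.addRight (-e x)).toOpenPartialHomeomorph)
    (contDiff_id.add contDiff_const).contDiffOn
    (contDiff_id.add contDiff_const).contDiffOn
  refine Manifold.IsImmersionAtOfComplement.mk_of_charts
    (ContinuousLinearEquiv.uniqueProd ℝ _ _)
    (chartAt (EuclideanSpace ℝ (Fin 0)) p) _ (mem_chart_source _ p) ?_
    (IsManifold.chart_mem_maximalAtlas p) hcod.mem_maximalAtlas (fun q _ => ?_) fun z _ => ?_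
  · simp
  · simp
  · simp [← he]

end Immersion

namespace SmoothDistribution

variable {m d k : ℕ} {M : Type u} [TopologicalSpace M]
  [ChartedSpace (EuclideanSpace ℝ (Fin d)) M] [IsManifold (𝓡 d) ∞ M]
  {D : SmoothDistribution m d M}

theorem IsIntegralManifold.comp_subtype_val {N : Type u} [TopologicalSpace N]
    [ChartedSpace (EuclideanSpace ℝ (Fin k)) N] [IsManifold (𝓡 k) ∞ N] {ι : N → M}
    (h : D.IsIntegralManifold k ι) (s : TopologicalSpace.Opens N) :
    D.IsIntegralManifold k (fun p : s => ι p) := by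
  refine ⟨h.immersion.comp_subtype_val s, h.injective.comp Subtype.val_injective, fun p => ?_⟩
  rintro _ ⟨v, rfl⟩
  have h1 := mfderiv_comp (I := 𝓡 k) (I' := 𝓡 k) (I'' := 𝓡 d) p (f := (Subtype.val : s → N))
    (h.immersion.contMDiff.mdifferentiable (by simp) p.1)
    ((contMDiff_subtype_val (n := ∞)).mdifferentiable (by simp) p)
  have h2 := h.tangent_le p.1 ⟨mfderiv (𝓡 k) (𝓡 k) (Subtype.val : s → N) p v, rfl⟩
  have h3 := congr($h1 v)
  change mfderiv (𝓡 k) (𝓡 d) (ι ∘ (Subtype.val : s → N)) p v ∈ D.space (ι p)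
  rw [h3]
  exact h2

theorem isIntegralManifold_const (D : SmoothDistribution m d M) {P : Type u} [TopologicalSpace P]
    [ChartedSpace (EuclideanSpace ℝ (Fin 0)) P] [IsManifold (𝓡 0) ∞ P] [Subsingleton P] (x : M) :
    D.IsIntegralManifold 0 (fun _ : P => x) := by
  refine ⟨Manifold.isImmersion_const x, Function.injective_of_subsingleton _, fun p => ?_⟩
  rintro _ ⟨v, rfl⟩
  rw [mfderiv_const]
  exact (D.space x).zero_mem

end SmoothDistribution

/-! ### Completely integrable distributions are involutive -/

namespace SmoothDistribution

section

variable {m d : ℕ} {M : Type u} [TopologicalSpace M]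
  [ChartedSpace (EuclideanSpace ℝ (Fin d)) M] [IsManifold (𝓡 d) ∞ M]

/-- There is an integral manifold of dimension `k` that meets `U`. As in the definition of maximality,
integral manifolds are second countable and live in the universe of `M`. -/
def ExistsIntegralManifoldMeeting (D : SmoothDistribution m d M) (U : Set M) (k : ℕ) : Prop :=
  ∃ (N : Type u) (_ : TopologicalSpace N) (_ : SecondCountableTopology N)
    (_ : ChartedSpace (EuclideanSpace ℝ (Fin k)) N) (_ : IsManifold (𝓡 k) ∞ N) (ι : N → M),
    D.IsIntegralManifold k ι ∧ (range ι ∩ U).Nonempty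

/-- Every nonempty open set meets a maximal integral manifold contained in it: among the integral
manifolds that meet the open set, restrict one of the largest dimension. -/
theorem exists_isMaximalIntegralManifold (D : SmoothDistribution m d M) {U : Set M}
    (hU : IsOpen U) (hne : U.Nonempty) :
    ∃ (k : ℕ) (N : Type u) (_ : TopologicalSpace N) (_ : SecondCountableTopology N)
      (_ : ChartedSpace (EuclideanSpace ℝ (Fin k)) N) (_ : IsManifold (𝓡 k) ∞ N) (ι : N → M),
      D.IsMaximalIntegralManifold k ι ∧ Nonempty N ∧ range ι ⊆ U := by
  classical
  obtain ⟨x, hx⟩ := hne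
  have h0 : D.ExistsIntegralManifoldMeeting U 0 :=
    ⟨Plaques.{u} Unit (⊤ : TopologicalSpace.Opens (EuclideanSpace ℝ (Fin 0))), inferInstance,
      inferInstance, inferInstance, inferInstance, _,
      have : Subsingleton (Plaques.{u} Unit
        (⊤ : TopologicalSpace.Opens (EuclideanSpace ℝ (Fin 0)))) :=
        ⟨fun p q => Plaques.ext rfl (Subsingleton.elim _ _)⟩
      D.isIntegralManifold_const x, x, ⟨Plaques.incl () ⟨0, trivial⟩, rfl⟩, hx⟩
  have hle : ∀ k, D.ExistsIntegralManifoldMeeting U k → k ≤ m := by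
    rintro k ⟨N, _, _, _, _, ι, hι, _, ⟨p, -⟩, -⟩
    exact hι.le p
  set k := Nat.findGreatest (D.ExistsIntegralManifoldMeeting U) m with hk
  obtain ⟨N, _, _, _, _, ι, hι, _, ⟨p, rfl⟩, hp⟩ :=
    Nat.findGreatest_spec (P := D.ExistsIntegralManifoldMeeting U) (Nat.zero_le m) h0
  let s : TopologicalSpace.Opens N := ⟨ι ⁻¹' U, hU.preimage hι.immersion.contMDiff.continuous⟩
  refine ⟨k, s, inferInstance, inferInstance, inferInstance, inferInstance, fun p => ι p,
    ⟨hι.comp_subtype_val s, ?_⟩, ⟨⟨p, hp⟩⟩, ?_⟩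
  · intro q W _ hqW k' N' _ _ _ _ ι' hk' hι' hsub
    have hk'U : D.ExistsIntegralManifoldMeeting U k' :=
      ⟨N', inferInstance, inferInstance, inferInstance, inferInstance, ι', hι', ι q,
        hsub ⟨⟨q, rfl⟩, hqW⟩, q.2⟩
    exact Nat.findGreatest_is_greatest hk' (hle k' hk'U) hk'U
  · rintro _ ⟨q, rfl⟩
    exact q.2

end

variable {m n : ℕ} {M : Type u} [TopologicalSpace M]
  [ChartedSpace (EuclideanSpace ℝ (Fin (m + n))) M] [IsManifold (𝓡 (m + n)) ∞ M]
  {D : SmoothDistribution m (m + n) M}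

theorem isOpen_mlieBracket_notMem {X Y : ∀ x : M, TangentSpace (𝓡 (m + n)) x}
    (hX : SmoothVectorFieldOn X univ) (hY : SmoothVectorFieldOn Y univ) :
    IsOpen {x | VectorField.mlieBracket (𝓡 (m + n)) X Y x ∉ D.space x} := by
  rw [isOpen_iff_eventually]
  intro x hx
  obtain ⟨κ, A, hκ, hxκ, hA, h⟩ := D.exists_isGraphIn x
  set Z := VectorField.mlieBracket (𝓡 (m + n)) X Y with hZ
  have hrep : ∀ y ∈ κ.source, Z y ∈ D.space y ↔
      (fieldRep κ Z (κ y)).2 - A (κ y) (fieldRep κ Z (κ y)).1 = 0 := by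
    intro y hy
    have h1 := hκ.fieldRep_eq_coordDeriv (κ.map_source hy) Z
    rw [κ.left_inv hy] at h1
    rw [h.mem_space_iff hκ hy, h1, sub_eq_zero]
  have hXs := hκ.contDiffOn_fieldRep isOpen_univ hX
  have hYs := hκ.contDiffOn_fieldRep isOpen_univ hY
  rw [preimage_univ, inter_univ] at hXs hYs
  have ht := κ.open_target.mem_nhds (κ.map_source hxκ)
  have hZc : ContinuousAt (fieldRep κ Z) (κ x) := by
    have h1 : fieldRep κ Z =ᶠ[𝓝 (κ x)]
        VectorField.lieBracket ℝ (fieldRep κ X) (fieldRep κ Y) := by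
      filter_upwards [ht] with z hz
      exact hκ.fieldRep_mlieBracket isOpen_univ hX hY hz (mem_univ _)
    refine ContinuousAt.congr ?_ h1.symm
    have hdX := ((hXs.contDiffAt ht).fderiv_right (m := 0) (by simp)).continuousAt
    have hdY := ((hYs.contDiffAt ht).fderiv_right (m := 0) (by simp)).continuousAt
    exact (hdY.clm_apply (hXs.contDiffAt ht).continuousAt).sub
      (hdX.clm_apply (hYs.contDiffAt ht).continuousAt)
  have hc : ContinuousAt (fun z => (fieldRep κ Z z).2 - A z (fieldRep κ Z z).1) (κ x) :=
    hZc.snd.sub ((hA.contDiffAt ht).continuousAt.clm_apply hZc.fst)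
  have hne := (hc.comp (κ.continuousAt hxκ)).eventually_ne (fun h0 => hx ((hrep x hxκ).2 h0))
  filter_upwards [hne, κ.open_source.mem_nhds hxκ] with y hy hyκ
  exact fun hyD => hy ((hrep y hyκ).1 hyD)

/-- If the bracket of two sections leaves `D` at some point, it does so on an open set, which no
integral manifold of full dimension meets. A maximal integral manifold in this open set then
contradicts complete integrability. -/
theorem IsCompletelyIntegrable.isInvolutive (hD : D.IsCompletelyIntegrable) :
    D.IsInvolutive := by
  intro X Y hX hY x
  by_contra hx
  obtain ⟨k, N, _, _, _, _, ι, hι, ⟨p⟩, hU⟩ :=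
    D.exists_isMaximalIntegralManifold (isOpen_mlieBracket_notMem hX.1 hY.1) ⟨x, hx⟩
  have h1 := hι.1.immersion.finrank_range_mfderiv p
  rw [hD k N ι hι p, D.finrank_space] at h1
  subst h1
  exact hU ⟨p, rfl⟩ (hι.1.mlieBracket_mem hX hY p)

theorem HasFullIntegralManifolds.isInvolutive (hD : D.HasFullIntegralManifolds) :
    D.IsInvolutive := by
  intro X Y hX hY x
  obtain ⟨N, _, _, _, _, ι, hι, ⟨p, rfl⟩, -⟩ := hD x
  exact hι.mlieBracket_mem hX hY p

end SmoothDistribution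

theorem mainTheorem1 {m n : ℕ} {M : Type u} [TopologicalSpace M] [T2Space M]
    [SecondCountableTopology M] [ChartedSpace (EuclideanSpace ℝ (Fin (m + n))) M]
    [IsManifold (𝓡 (m + n)) ∞ M] (D : SmoothDistribution m (m + n) M) :
    (D.IsCompletelyIntegrable ↔ D.IsInvolutive) ∧
    (D.HasFullIntegralManifolds ↔ D.IsInvolutive) ∧
    (D.IsInvolutive → ∀ X : ∀ x : M, TangentSpace (𝓡 (m + n)) x, D.IsSection X →
      D.IsInfinitesimalSymmetry X ∧
      ∀ (k : ℕ) (N : Type u) [TopologicalSpace N] [SecondCountableTopology N]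
        [ChartedSpace (EuclideanSpace ℝ (Fin k)) N] [IsManifold (𝓡 k) ∞ N] (ι : N → M),
        D.IsMaximalIntegralManifold k ι →
        ∀ p : N, X (ι p) ∈ LinearMap.range (mfderiv (𝓡 k) (𝓡 (m + n)) ι p).toLinearMap) := by
  refine ⟨⟨fun h => h.isInvolutive, fun h => h.isCompletelyIntegrable⟩,
    ⟨fun h => h.isInvolutive, fun h => h.hasFullIntegralManifolds⟩, fun h X hX =>
    ⟨h.isInfinitesimalSymmetry hX, fun k N _ _ _ _ ι hι p => ?_⟩⟩
  rw [h.isCompletelyIntegrable k N ι hι p]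
  exact hX.2 (ι p)
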